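/- **Setting.** A task $\tau_i$ has a criticality level $L_i\in\{LC,HC\}$, minimum separation $T_i$, WCETs $C_i^L,C_i^H$, relative deadline $D_i$ and tightened deadline $D_i^L$ (real numbers), with $C_i^L>0$ and $0<D_i^L\le D_i\le T_i$; $C_i^L<C_i^H$ if $L_i=HC$; $C_i^L=C_i^H\le D_i=D_i^L$ if $L_i=LC$. A system is a finite set of tasks partitioned into $p$ HC components and $q$ LC components $\mathbb C_1,\dots,\mathbb C_{p+q}$, each with a tolerance limit $TL_j\in\mathbb N$; a component is LC if all its tasks are LC, and then $TL_j=0$; otherwise it is HC. **Execution.** Each task releases jobs at instants at least $T_i$ apart; each job has an execution requirement in $[0,C_i^H]$. One processor executes the jobs preemptively. An HC task overruns when one of its jobs has executed for $C_i^L$ without completing. The internal mode of a component is HC from the first overrun of one of its HC tasks (IMS), its external mode is HC from the instant when more than $TL_j$ of its HC tasks have overrun (EMS). An HC task is in HC mode once it has overrun or some component of the system has had its EMS, and in LC mode before. The jobs of an LC task are dropped once its own component has had its IMS or any component has had its EMS. At any instant at which no earlier released job is pending in the system, a component may switch its modes back to LC. At every time the processor executes a pending (released, uncompleted, not dropped)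 job with the earliest absolute deadline, if there is one; the relative deadline used is $D_i$ for HC tasks in HC mode and $D_i^L$ otherwise. The system is *schedulable* (flat framework) if in every such run: each job of an HC task completes by its deadline $D_i$; if its task is in LC mode until the job's tightened deadline, the job by then has completed or received $C_i^L$ units; and each job of an LC task that is not dropped before its deadline completes by its deadline. **Demand bound functions.** For $r\in\mathbb R$ put $$\mathrm{dbf}(J^A_i,t,t_i)=\begin{cases}C_i^L,& r+D_i^L<t_i\\ C_i^H,& r+D_i^L\ge t_i,\ r+D_i\le t\\ \min\{t_i-r,C_i^L\},& t_i\le r+D_i^L\le t,\ r+D_i>t\\ 0,& r+D_i^L>t\end{cases}\qquad \mathrm{dbf}(J^B_i,t,t_i)=\begin{cases}\min\{t_i-r,C_i^L\},& r+D_i^L\le t\\0,&\text{otherwise.}\end{cases}$$ With $r=\lfloor t_i/T_i\rfloor T_i$ let $\mathrm{dbf}_{[a]}=\lfloor t_i/T_i\rfloor C_i^L+\mathrm{dbf}(J_i^B,t,t_i)$ and $\mathrm{dbf}_{[b]}=\lfloor t_i/T_i\rfloor C_i^L+\mathrm{dbf}(J_i^A,t,t_i)$. With $r_0=t-D_i-\lfloor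 (t-D_i)/T_i\rfloor T_i$, $b_i=\max\{0,\lfloor (t_i-r_0)/T_i\rfloor\}$, $a_i=\lfloor (t-D_i)/T_i\rfloor-b_i$ and $r=r_0+b_iT_i$ let $\mathrm{dbf}_{[c]}=b_iC_i^L+\mathrm{dbf}(J_i^A,t,t_i)+a_iC_i^H$. Then $\mathrm{dbf}(\tau_i,t,t_i)$ is $\mathrm{dbf}_{[a]}$ if $L_i=LC$; and if $L_i=HC$ it is $\mathrm{dbf}_{[b]}$ when $t-t_i<D_i-D_i^L$, $\mathrm{dbf}_{[c]}$ when $t-t_i\ge D_i$, and $\max\{\mathrm{dbf}_{[b]},\mathrm{dbf}_{[c]}\}$ otherwise. For a component with $TL_j=0$ (where IMS and EMS coincide) $\mathrm{dbf}(\mathbb C_j,t,t_E,t_I)=\sum_{\tau_i\in\mathbb C_j}\mathrm{dbf}(\tau_i,t,t_E)$. If $TL_j>0$, $$\mathrm{dbf}(\mathbb C_j,t,t_E,t_I)=\sum_{L_i=HC}\mathrm{dbf}(\tau_i,t,t_E)+\sum_{\tau_i\in\mathcal G}\Delta_i+\sum_{L_i=LC}\mathrm{dbf}(\tau_i,t,t_I),$$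 sums over $\tau_i\in\mathbb C_j$, where $\Delta_i=\max\{0,\mathrm{dbf}(\tau_i,t,t_I)-\mathrm{dbf}(\tau_i,t,t_E)\}$ and $\mathcal G$ consists of $TL_j$ HC tasks of $\mathbb C_j$ with the largest $\Delta_i$ (all of them if there are fewer). **The bound.** Let $U_L^L(j)=\sum_{L_i=LC}C_i^L/T_i$, $U_H^L(j)=\sum_{L_i=HC}C_i^L/T_i$, $U_H^H(j)=\sum_{L_i=HC}C_i^H/T_i$ (over $\tau_i\in\mathbb C_j$), let $A$ be the set of components with $U_L^L(j)+U_H^L(j)<U_H^H(j)$ and $B$ the set of the others, $\sigma=1-\sum_{A}U_H^H(j)-\sum_{B}(U_L^L(j)+U_H^L(j))$, and $$t_{MAX}=\frac1\sigma\sum_{j=1}^{p+q}\Big(\max_{\tau_i\in\mathbb C_j}\{2T_i-D_i\}\,U_H^H(j)+\sum_{\tau_i\in\mathbb C_j,\,L_i=LC}C_i^L\Big)$$ if $\sigma>0$, $t_{MAX}=\infty$ if $\sigma\le0$. **Theorem.** (1) The system is schedulable under the flat framework if for all $0\le t\le t_{MAX}$ ($t<\infty$), all $0\le t_E\le t$ and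 all $t_{I1},\dots,t_{I(p+q)}\in[0,t_E]$, $$\sum_{j=1}^{p+q}\mathrm{dbf}(\mathbb C_j,t,t_E,t_{Ij})\le t .$$ (2) $t_{MAX}$ is pseudo-polynomial for systems whose utilization $1-\sigma$ is bounded away from $1$: there is a polynomial $P$ such that for every $\varepsilon>0$ and every system with natural-number parameters and $\sigma\ge\varepsilon$ one has $t_{MAX}\le P(N)/\varepsilon$, where $N$ is the number of components and tasks plus the sum of all parameters (the size of the input in unary). -/

import Mathlib

open MeasureTheory

noncomputable section

/-! ## Tasks, components, systems -/

/-- The two criticality levels. -/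
inductive Criticality where
  | LC
  | HC

/-- A constrained-deadline mixed-criticality sporadic task: criticality `crit`, minimum separation
`T`, WCETs `CL` and `CH`, relative deadline `D` and tightened deadline `DL`. The field `lc_fit`
says that the (only) WCET of an LC task fits into its deadline; nothing of the kind is assumed of
HC tasks. -/
structure MCTask where
  crit : Criticality
  T : ℝ
  CL : ℝ
  CH : ℝ
  D : ℝ
  DL : ℝ
  CL_pos : 0 < CL
  DL_pos : 0 < DL
  DL_le : DL ≤ D
  D_le : D ≤ T
  hc_wcet : crit = Criticality.HC → CL < CH
  lc_wcet : crit = Criticality.LC → CL = CH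
  lc_deadline : crit = Criticality.LC → DL = D
  lc_fit : crit = Criticality.LC → CL ≤ D

/-- A system: tasks indexed by `ι`, partitioned into components indexed by `κ` (`comp i` is the
component of task `i`), each component with a tolerance limit `TL`. A component all of whose tasks
are LC tasks is an LC component and has tolerance limit `0`; all others are HC components. -/
structure MCSystem (κ ι : Type*) where
  task : ι → MCTask
  comp : ι → κ
  TL : κ → ℕ
  TL_lc : ∀ j, (∀ i, comp i = j → (task i).crit = Criticality.LC) → TL j = 0

/-! ## Demand bound functions -/

namespace MCTask

/-- Demand in `[0,t)` of the last job released (at `r`) by an HC task before its switch to HC mode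
at `ti`. -/
def dbfJobA (τ : MCTask) (t ti r : ℝ) : ℝ :=
  if r + τ.DL < ti then τ.CL
  else if r + τ.D ≤ t then τ.CH
  else if r + τ.DL ≤ t then min (ti - r) τ.CL
  else 0

/-- Demand in `[0,t)` of the last job released (at `r`) by an LC task before it is dropped
at `ti`. -/
def dbfJobB (τ : MCTask) (t ti r : ℝ) : ℝ :=
  if r + τ.DL ≤ t then min (ti - r) τ.CL else 0

/-- Condition a (LC task): the first job is released at `0`, later ones with period `T`. -/
def dbfA (τ : MCTask) (t ti : ℝ) : ℝ :=
  (⌊ti / τ.T⌋ : ℝ) * τ.CL + τ.dbfJobB t ti ((⌊ti / τ.T⌋ : ℝ) * τ.T)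

/-- Condition b (HC task): the first job is released at `0`, later ones with period `T`. -/
def dbfB (τ : MCTask) (t ti : ℝ) : ℝ :=
  (⌊ti / τ.T⌋ : ℝ) * τ.CL + τ.dbfJobA t ti ((⌊ti / τ.T⌋ : ℝ) * τ.T)

/-- Release instant of the first job in the pattern in which some job has its deadline at `t`. -/
def firstRelease (τ : MCTask) (t : ℝ) : ℝ :=
  t - τ.D - (⌊(t - τ.D) / τ.T⌋ : ℝ) * τ.T

/-- The number `b_i` of jobs before the special job in that pattern. Being a number of jobs it is a
natural number: the floor `⌊·⌋₊` is `0` when its argument is negative, that is when `ti` precedes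
the first release. -/
def numBefore (τ : MCTask) (t ti : ℝ) : ℕ :=
  ⌊(ti - τ.firstRelease t) / τ.T⌋₊

/-- Condition c (HC task): the first job is released at `firstRelease`, later ones with period
`T`. -/
def dbfC (τ : MCTask) (t ti : ℝ) : ℝ :=
  (τ.numBefore t ti : ℝ) * τ.CL
    + τ.dbfJobA t ti (τ.firstRelease t + (τ.numBefore t ti : ℝ) * τ.T)
    + ((⌊(t - τ.D) / τ.T⌋ : ℝ) - (τ.numBefore t ti : ℝ)) * τ.CH

/-- The demand bound function of a task; the last case is condition d. -/
def dbf (τ : MCTask) (t ti : ℝ) : ℝ :=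
  match τ.crit with
  | Criticality.LC => τ.dbfA t ti
  | Criticality.HC =>
      if t - ti < τ.D - τ.DL then τ.dbfB t ti
      else if τ.D ≤ t - ti then τ.dbfC t ti
      else max (τ.dbfB t ti) (τ.dbfC t ti)

end MCTask

namespace MCSystem

variable {κ ι : Type*} [Fintype κ] [Fintype ι]

open Classical in
/-- The LC tasks of component `j`. -/
def lcTasks (S : MCSystem κ ι) (j : κ) : Finset ι :=
  {i | S.comp i = j ∧ (S.task i).crit = Criticality.LC}

open Classical in
/-- The HC tasks of component `j`. -/
def hcTasks (S : MCSystem κ ι) (j : κ) : Finset ι :=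
  {i | S.comp i = j ∧ (S.task i).crit = Criticality.HC}

/-- The largest increase of the demand of task `i` when it switches at `tI` rather than `tE`. -/
def delta (S : MCSystem κ ι) (t tE tI : ℝ) (i : ι) : ℝ :=
  max 0 ((S.task i).dbf t tI - (S.task i).dbf t tE)

/-- The sum of the `TL j` largest values `delta` over the HC tasks of component `j` (of all of them
if there are fewer), written as the maximum of the sums over sets `G` of at most `TL j` HC tasks. -/
def deltaSum (S : MCSystem κ ι) (j : κ) (t tE tI : ℝ) : ℝ :=
  ((S.hcTasks j).powerset.filter (fun G => G.card ≤ S.TL j)).sup' ⟨∅, by simp⟩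
    (fun G => ∑ i ∈ G, S.delta t tE tI i)

/-- The demand bound function of component `j`. If `TL j = 0` the internal and the external mode
switch at the same instant `tE`, and `tI` plays no role. -/
def compDbf (S : MCSystem κ ι) (j : κ) (t tE tI : ℝ) : ℝ :=
  if S.TL j = 0 then
    ∑ i ∈ S.hcTasks j, (S.task i).dbf t tE + ∑ i ∈ S.lcTasks j, (S.task i).dbf t tE
  else
    ∑ i ∈ S.hcTasks j, (S.task i).dbf t tE + S.deltaSum j t tE tI
      + ∑ i ∈ S.lcTasks j, (S.task i).dbf t tI

/-! ## The bound on the interval lengths to be checked -/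

/-- `U_L^L(j)`. -/
def utilLL (S : MCSystem κ ι) (j : κ) : ℝ := ∑ i ∈ S.lcTasks j, (S.task i).CL / (S.task i).T

/-- `U_H^L(j)`. -/
def utilHL (S : MCSystem κ ι) (j : κ) : ℝ := ∑ i ∈ S.hcTasks j, (S.task i).CL / (S.task i).T

/-- `U_H^H(j)`. -/
def utilHH (S : MCSystem κ ι) (j : κ) : ℝ := ∑ i ∈ S.hcTasks j, (S.task i).CH / (S.task i).T

/-- Maximum of `2 T_i - D_i` over the tasks of component `j` (`0` if it has no task). -/
def maxTwoTSubD (S : MCSystem κ ι) (j : κ) : ℝ :=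
  ⨆ i : {i : ι // S.comp i = j}, (2 * (S.task i).T - (S.task i).D)

/-- The numerator of `t_MAX`. -/
def tMaxNum (S : MCSystem κ ι) : ℝ :=
  ∑ j, (S.maxTwoTSubD j * S.utilHH j + ∑ i ∈ S.lcTasks j, (S.task i).CL)

/-- The denominator of `t_MAX`: one minus the utilization, in which a component of the set `A`
counts with `U_H^H(j)` and one of the set `B` with `U_L^L(j) + U_H^L(j)`. -/
def slack (S : MCSystem κ ι) : ℝ :=
  1 - ∑ j, if S.utilLL j + S.utilHL j - S.utilHH j < 0 then S.utilHH j
    else S.utilLL j + S.utilHL j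

/-- `t_MAX`. If the denominator is not positive there is no bound, and all interval lengths have to
be checked. -/
def tMax (S : MCSystem κ ι) : EReal :=
  if 0 < S.slack then ((S.tMaxNum / S.slack : ℝ) : EReal) else ⊤

/-- The schedulability test for the flat framework. -/
def PassesTest (S : MCSystem κ ι) : Prop :=
  ∀ t : ℝ, 0 ≤ t → (t : EReal) ≤ S.tMax → ∀ tE : ℝ, 0 ≤ tE → tE ≤ t →
    ∀ tI : κ → ℝ, (∀ j, 0 ≤ tI j ∧ tI j ≤ tE) → ∑ j, S.compDbf j t tE (tI j) ≤ t

end MCSystem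

/-! ## Run-time behaviour under flat EDF scheduling -/

/-- Raw data of a run of a system on one processor in continuous time. A job is a pair of a task `i`
and a release instant `r ∈ rel i`; `exec i r` is its actual execution requirement; `proc x` is the
job that the processor executes at time `x` (`none` if it idles); `reset j` is the set of instants
at which both modes of component `j` are switched back to LC. -/
structure Run (κ ι : Type*) where
  rel : ι → Set ℝ
  exec : ι → ℝ → ℝ
  proc : ℝ → Option (ι × ℝ)
  reset : κ → Set ℝ

namespace Run

variable {κ ι : Type*}

/-- Processor time received before time `x` by the job of task `i` released at `r`. -/
def served (R : Run κ ι) (i : ι) (r x : ℝ) : ℝ :=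
  (volume {y : ℝ | 0 ≤ y ∧ y < x ∧ R.proc y = some (i, r)}).toReal

/-- Some job of task `i` has, by time `x`, executed for its LC WCET without completing at that
point, and so has requested more, and the modes of its component have not been reset since. -/
def Overrun (S : MCSystem κ ι) (R : Run κ ι) (i : ι) (x : ℝ) : Prop :=
  ∃ r ∈ R.rel i, r ≤ x ∧ (S.task i).CL < R.exec i r ∧ (S.task i).CL ≤ R.served i r x ∧
    ∀ s ∈ R.reset (S.comp i), ¬ (r < s ∧ s ≤ x)

/-- The internal mode of component `j` is HC at time `x`. -/
def InternalHC (S : MCSystem κ ι) (R : Run κ ι) (j : κ) (x : ℝ) : Prop :=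
  ∃ i, S.comp i = j ∧ (S.task i).crit = Criticality.HC ∧ R.Overrun S i x

/-- The external mode of component `j` is HC at time `x`: more than `TL j` of its HC tasks have
switched to HC mode. -/
def ExternalHC (S : MCSystem κ ι) (R : Run κ ι) (j : κ) (x : ℝ) : Prop :=
  S.TL j < {i | S.comp i = j ∧ (S.task i).crit = Criticality.HC ∧ R.Overrun S i x}.ncard

/-- Some component of the system has its external mode equal to HC at time `x`. -/
def SystemHC (S : MCSystem κ ι) (R : Run κ ι) (x : ℝ) : Prop :=
  ∃ j, R.ExternalHC S j x

/-- The HC task `i` is in HC mode at time `x`: by its own overrun, or because of an external mode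
switch in the system, after which all HC tasks are in HC mode. -/
def TaskHC (S : MCSystem κ ι) (R : Run κ ι) (i : ι) (x : ℝ) : Prop :=
  (S.task i).crit = Criticality.HC ∧ (R.Overrun S i x ∨ R.SystemHC S x)

/-- At time `x` the jobs of the LC task `i` are dropped: the internal mode of its component or the
external mode of some component is HC. -/
def Drops (S : MCSystem κ ι) (R : Run κ ι) (i : ι) (x : ℝ) : Prop :=
  (S.task i).crit = Criticality.LC ∧ (R.InternalHC S (S.comp i) x ∨ R.SystemHC S x)

/-- The job of task `i` released at `r` is pending at time `x`: released, not completed, and not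
dropped at any instant since its release. -/
def Pending (S : MCSystem κ ι) (R : Run κ ι) (i : ι) (r x : ℝ) : Prop :=
  r ∈ R.rel i ∧ r ≤ x ∧ R.served i r x < R.exec i r ∧ ∀ y, r ≤ y → y ≤ x → ¬ R.Drops S i y

open Classical in
/-- The absolute deadline by which the job of task `i` released at `r` is scheduled at time `x`. -/
def deadline (S : MCSystem κ ι) (R : Run κ ι) (i : ι) (r x : ℝ) : ℝ :=
  if R.TaskHC S i x then r + (S.task i).D else r + (S.task i).DL

/-- `R` is a legal run of `S` under preemptive EDF with deadline tightening. Job arrivals and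
execution requirements are arbitrary within the task parameters, ties are broken arbitrarily, and a
component may, but need not, switch its modes back to LC at any instant at which no job released
earlier is pending in the system. -/
structure Legal (S : MCSystem κ ι) (R : Run κ ι) : Prop where
  rel_nonneg : ∀ i, ∀ r ∈ R.rel i, 0 ≤ r
  rel_sep : ∀ i, ∀ r ∈ R.rel i, ∀ r' ∈ R.rel i, r < r' → r + (S.task i).T ≤ r'
  exec_nonneg : ∀ i, ∀ r ∈ R.rel i, 0 ≤ R.exec i r
  exec_le : ∀ i, ∀ r ∈ R.rel i, R.exec i r ≤ (S.task i).CH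
  measurable_proc : ∀ i r, MeasurableSet {y : ℝ | R.proc y = some (i, r)}
  edf : ∀ x, 0 ≤ x → ∀ i r, R.proc x = some (i, r) →
    R.Pending S i r x ∧ ∀ i' r', R.Pending S i' r' x → R.deadline S i r x ≤ R.deadline S i' r' x
  work_conserving : ∀ x, 0 ≤ x → R.proc x = none → ∀ i r, ¬ R.Pending S i r x
  reset_idle : ∀ j, ∀ s ∈ R.reset j, ∀ i, ∀ r ∈ R.rel i, r < s → ¬ R.Pending S i r s

/-- All the requirements on a run are met: every job of an HC task completes by its deadline; it
receives its LC WCET (or completes) by its tightened deadline if its task is in LC mode until then;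
and every job of an LC task that is not dropped before its deadline completes by its deadline. -/
structure MeetsRequirements (S : MCSystem κ ι) (R : Run κ ι) : Prop where
  hc_deadline : ∀ i, (S.task i).crit = Criticality.HC → ∀ r ∈ R.rel i,
    R.exec i r ≤ R.served i r (r + (S.task i).D)
  hc_tightened : ∀ i, (S.task i).crit = Criticality.HC → ∀ r ∈ R.rel i,
    (∀ y, r ≤ y → y < r + (S.task i).DL → ¬ R.TaskHC S i y) →
      min (R.exec i r) (S.task i).CL ≤ R.served i r (r + (S.task i).DL)
  lc_deadline : ∀ i, (S.task i).crit = Criticality.LC → ∀ r ∈ R.rel i,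
    (∀ y, r ≤ y → y < r + (S.task i).D → ¬ R.Drops S i y) →
      R.exec i r ≤ R.served i r (r + (S.task i).D)

end Run

namespace MCSystem

/-- The system is schedulable: every legal run meets all its requirements. -/
def Schedulable {κ ι : Type*} (S : MCSystem κ ι) : Prop :=
  ∀ R : Run κ ι, R.Legal S → R.MeetsRequirements S

/-- The task parameters are natural numbers. -/
def Integral {κ ι : Type*} (S : MCSystem κ ι) : Prop :=
  ∀ i, ∃ T CL CH D DL : ℕ, (S.task i).T = T ∧ (S.task i).CL = CL ∧ (S.task i).CH = CH ∧
    (S.task i).D = D ∧ (S.task i).DL = DL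

/-- Size of the input with numbers written in unary (for natural parameters): the number of
components and tasks plus the sum of all parameters. A bound that is polynomial in it is
pseudo-polynomial in the input. -/
def unarySize {κ ι : Type*} [Fintype κ] [Fintype ι] (S : MCSystem κ ι) : ℝ :=
  Fintype.card κ + Fintype.card ι + ∑ j, (S.TL j : ℝ)
    + ∑ i, ((S.task i).T + (S.task i).CL + (S.task i).CH + (S.task i).D + (S.task i).DL)

end MCSystem

end

/-!
Sufficiency of the demand test rests on the busy-interval argument of earliest-deadline-first
analysis; the pseudo-polynomial bound on `t_MAX` is a direct estimate of its numerator, since `T ≥ 1`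
for natural parameters (`MCSystem.tMaxNum_le`).

Suppose that some requirement is missed at `d`, and that no tightened requirement is missed before
`d`. Let `s` be the last instant, up to the release of the job concerned, at which no job released
earlier is pending with a deadline at most `d`. In `(s,d)` the processor works only for jobs released
in `[s,d)` with deadline at most `d` (`Run.Legal.exists_busy_start`). At every `y` in
`(s,d)` some job released before `y` is pending, so no modes are reset there. Hence modes only rise,
and each task `i` has one switching instant `x i` in `[s,d]`: its drop instant if it is an LC task,
otherwise its switch to HC mode, and `d` if there is none (`Run.exists_switches`). Modes that are HC
already at `s` are covered by a switch at `s`. What a job receives in `[s,d)` is then bounded by a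
function of its release and `x i` alone, `MCTask.demand` (`Run.Legal.served_le_demand`), and the
demand of the job that misses its requirement covers even what it should have received. The
processor being busy, the total demand exceeds `d - s` by at least the amount missing, while the
test bounds it by `d - s` (`MCSystem.PassesTest.sum_demand_le`).

That bound has three sources.
* For one task, the demand of any admissible release pattern is at most the demand bound function
  (`MCTask.sum_lcDemand_le`, `MCTask.sum_hcDemand_le`): if some job of an HC task can need `C^H` in
  full, then the pattern with a deadline at the end of the interval is the worst one and earlier
  switches are worse; otherwise the pattern with a release at the start is, and later switches are
  worse. So a switch between `t_I` and `t_E` is dominated by one at `t_I` or at `t_E`.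
* At most `TL j` HC tasks of component `j` switch before `t_E`, by their own overruns, and they do
  so no earlier than the internal switch; the terms `Δ` of the component bound account for them.
* For `t > t_MAX` the test inequality is automatic: the demand is at most `(1 - σ) t` plus the
  numerator of `t_MAX` (`MCSystem.compDbf_le`).

Boundary coincidences need care. When `D^L = D = T` and the distance from the switch to the end `t`
of the interval is a multiple of `T`, the demand bound function can miss the overrun of a job whose
deadline is the switching instant. The end of the interval is therefore moved from `d` to a slightly
later instant that avoids these countably many coincidences, by less than the amount missing. The
test also forces `C^L ≤ D^L` for HC tasks (`MCSystem.PassesTest.CL_le_DL`), which the task model does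
not assume.
-/

noncomputable section

/-! ### Separated release patterns -/

/-- Distinct elements of `R` are at least `T` apart. -/
def Separated (T : ℝ) (R : Set ℝ) : Prop :=
  ∀ r ∈ R, ∀ r' ∈ R, r < r' → r + T ≤ r'

theorem Separated.mono {T : ℝ} {R R' : Set ℝ} (h : Separated T R) (hR : R' ⊆ R) :
    Separated T R' :=
  fun r hr r' hr' => h r (hR hr) r' (hR hr')

theorem Separated.card_le {T a : ℝ} (R : Finset ℝ) :
    ∀ {b : ℝ}, Separated T R → (∀ r ∈ R, a ≤ r) → (∀ r ∈ R, r ≤ b) → R.Nonempty →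
    ((R.card : ℝ) - 1) * T ≤ b - a := by
  induction R using Finset.induction_on_max with
  | empty => intro b _ _ _ h; simp at h
  | insert m R hm ih =>
    intro b hsep ha hb _
    have hmR : m ∉ R := fun h => lt_irrefl _ (hm m h)
    rw [Finset.card_insert_of_notMem hmR]
    have h1 : a ≤ m := ha m (Finset.mem_insert_self _ _)
    have h2 : m ≤ b := hb m (Finset.mem_insert_self _ _)
    rcases R.eq_empty_or_nonempty with rfl | hne
    · simp; linarith
    · have := ih (b := m - T) (hsep.mono (by simp)) (fun r hr => ha r (by simp [hr]))
        (fun r hr => by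
          have := hsep r (by simp [hr]) m (by simp) (hm r hr)
          linarith) hne
      push_cast
      linarith

theorem Separated.finite {T : ℝ} (hT : 0 < T) {R : Set ℝ} (h : Separated T R) (a b : ℝ) :
    (R ∩ Set.Icc a b).Finite := by
  refine Set.Finite.of_finite_image (f := fun r => ⌊r / T⌋)
    ((Set.finite_Icc ⌊a / T⌋ ⌊b / T⌋).subset ?_) ?_
  · rintro _ ⟨r, ⟨-, h1, h2⟩, rfl⟩
    exact ⟨Int.floor_mono (by gcongr), Int.floor_mono (by gcongr)⟩
  · have key : ∀ r ∈ R, ∀ r' ∈ R, r < r' → ⌊r / T⌋ < ⌊r' / T⌋ := by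
      intro r hr r' hr' hlt
      have := h r hr r' hr' hlt
      have h2 : r / T + 1 ≤ r' / T := by
        rw [div_add_one hT.ne']; gcongr
      have := Int.floor_mono h2
      rw [Int.floor_add_one] at this
      omega
    intro r hr r' hr' heq
    simp only at heq
    rcases lt_trichotomy r r' with hlt | rfl | hlt
    · exact absurd heq (key r hr.1 r' hr'.1 hlt).ne
    · rfl
    · exact absurd heq (key r' hr'.1 r hr.1 hlt).ne'

/-- For a weight `φ` that decreases with the release instant and vanishes from `x` on, the densest
pattern starting at `0` is the worst one. -/
theorem Separated.sum_antitone_le {T C x : ℝ} (hT : 0 < T) (hx : 0 ≤ x) {φ : ℝ → ℝ}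
    (hanti : Antitone φ) (h0 : ∀ r, 0 ≤ φ r) (hC : ∀ r, φ r ≤ C) (hvan : ∀ r, x ≤ r → φ r = 0)
    (R : Finset ℝ) (hsep : Separated T R) (hR : ∀ r ∈ R, 0 ≤ r) :
    ∑ r ∈ R, φ r ≤ (⌊x / T⌋ : ℝ) * C + φ ((⌊x / T⌋ : ℝ) * T) := by
  have hC0 : 0 ≤ C := (h0 0).trans (hC 0)
  have hk0 : (0 : ℤ) ≤ ⌊x / T⌋ := Int.floor_nonneg.2 (by positivity)
  have hk0' : (0 : ℝ) ≤ (⌊x / T⌋ : ℝ) := by exact_mod_cast hk0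
  have hsum : ∑ r ∈ R, φ r = ∑ r ∈ R.filter (· < x), φ r := by
    rw [Finset.sum_filter_of_ne]
    intro r _ hne
    by_contra hge
    exact hne (hvan r (not_lt.1 hge))
  rw [hsum]
  set R' := R.filter (· < x) with hR'
  rcases R'.eq_empty_or_nonempty with he | hne
  · rw [he, Finset.sum_empty]
    exact add_nonneg (mul_nonneg hk0' hC0) (h0 _)
  set m := R'.max' hne
  have hm : m ∈ R' := R'.max'_mem hne
  have hcard := Separated.card_le (a := 0) (b := m) R'
    (hsep.mono (by exact_mod_cast Finset.filter_subset _ R))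
    (fun r hr => hR r (Finset.mem_filter.1 hr).1) (fun r hr => R'.le_max' r hr) hne
  rw [sub_zero] at hcard
  have hmx : m < x := (Finset.mem_filter.1 hm).2
  have hle : (R'.card : ℤ) - 1 ≤ ⌊x / T⌋ := by
    rw [Int.le_floor, le_div_iff₀ hT]
    push_cast
    linarith
  have hcR : (R'.card : ℝ) = ((R'.erase m).card : ℝ) + 1 := by
    rw [← Finset.card_erase_add_one hm]; push_cast; ring
  rcases hle.lt_or_eq with hlt | heq
  · have h1 : ∑ r ∈ R', φ r ≤ R'.card * C := by
      have := Finset.sum_le_card_nsmul R' φ C (fun r _ => hC r)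
      simpa using this
    have h2 : (R'.card : ℝ) ≤ (⌊x / T⌋ : ℝ) := by
      have : (R'.card : ℤ) ≤ ⌊x / T⌋ := by omega
      exact_mod_cast this
    nlinarith [h0 ((⌊x / T⌋ : ℝ) * T)]
  · have heq' : (R'.card : ℝ) - 1 = (⌊x / T⌋ : ℝ) := by exact_mod_cast heq
    rw [← Finset.sum_erase_add _ _ hm, ← heq']
    have h1 : ∑ r ∈ R'.erase m, φ r ≤ (R'.erase m).card * C := by
      have := Finset.sum_le_card_nsmul (R'.erase m) φ C (fun r _ => hC r)
      simpa using this
    have h2 : φ m ≤ φ (((R'.card : ℝ) - 1) * T) := hanti hcard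
    have h3 : (R'.card : ℝ) - 1 = ((R'.erase m).card : ℝ) := by linarith
    rw [h3] at h2 ⊢
    linarith

/-! ### Demand of a single task -/

namespace MCTask

theorem D_pos (τ : MCTask) : 0 < τ.D := τ.DL_pos.trans_le τ.DL_le

theorem T_pos (τ : MCTask) : 0 < τ.T := τ.D_pos.trans_le τ.D_le

theorem CL_le_CH (τ : MCTask) : τ.CL ≤ τ.CH := by
  cases h : τ.crit
  · exact (τ.lc_wcet h).le
  · exact (τ.hc_wcet h).le

theorem CH_pos (τ : MCTask) : 0 < τ.CH := τ.CL_pos.trans_le τ.CL_le_CH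

/-- Demand in `[0,t)` of the job released at `r` of an LC task that is dropped at `x`; it is `0` if
`x ≤ r`. -/
def lcDemand (τ : MCTask) (t x r : ℝ) : ℝ :=
  if r + τ.DL ≤ t then max 0 (min (x - r) τ.CL) else 0

/-- Demand in `[0,t)` of the job released at `r` of an HC task that switches to HC mode at `x`. Unlike
`dbfJobA`, it is meant for the jobs released before the switch and for those released after it; the
last branch is a job with deadline after `t`, which is served only until the switch. -/
def hcDemand (τ : MCTask) (t x r : ℝ) : ℝ :=
  if r + τ.DL < x then τ.CL
  else if r + τ.D ≤ t then τ.CH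
  else τ.lcDemand t x r

/-- Demand in `[0,t)` of the job released at `r` when the task is dropped (LC task) or switches to
HC mode (HC task) at `x`. -/
def demand (τ : MCTask) (t x r : ℝ) : ℝ :=
  match τ.crit with
  | Criticality.LC => τ.lcDemand t x r
  | Criticality.HC => τ.hcDemand t x r

theorem lcDemand_nonneg (τ : MCTask) (t x r : ℝ) : 0 ≤ τ.lcDemand t x r := by
  unfold lcDemand; split_ifs <;> simp

theorem lcDemand_le (τ : MCTask) (t x r : ℝ) : τ.lcDemand t x r ≤ τ.CL := by
  have := τ.CL_pos
  unfold lcDemand; split_ifs <;> simp [this.le]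

theorem lcDemand_eq_zero (τ : MCTask) {t x r : ℝ} (h : x ≤ r) : τ.lcDemand t x r = 0 := by
  unfold lcDemand; split_ifs
  · exact max_eq_left ((min_le_left _ _).trans (by linarith))
  · rfl

theorem lcDemand_antitone (τ : MCTask) (t x : ℝ) : Antitone (τ.lcDemand t x) := by
  intro r r' h
  unfold lcDemand
  split_ifs with h1 h2
  · gcongr
  · linarith
  · simp
  · rfl

theorem lcDemand_mono (τ : MCTask) (t r : ℝ) {x x' : ℝ} (h : x ≤ x') :
    τ.lcDemand t x r ≤ τ.lcDemand t x' r := by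
  unfold lcDemand
  split_ifs
  · gcongr
  · rfl

theorem demand_sub (τ : MCTask) (t x r s : ℝ) :
    τ.demand (t - s) (x - s) (r - s) = τ.demand t x r := by
  have h1 : ∀ a : ℝ, r - s + a < x - s ↔ r + a < x := fun a => by
    constructor <;> intro h <;> linarith
  have h2 : ∀ a : ℝ, r - s + a ≤ t - s ↔ r + a ≤ t := fun a => by
    constructor <;> intro h <;> linarith
  unfold demand hcDemand lcDemand
  simp only [h1, h2, sub_sub_sub_cancel_right]

theorem sum_lcDemand_le (τ : MCTask) {t x : ℝ} (hx : 0 ≤ x)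
    (R : Finset ℝ) (hsep : Separated τ.T R) (hR : ∀ r ∈ R, 0 ≤ r) :
    ∑ r ∈ R, τ.lcDemand t x r ≤ τ.dbfA t x := by
  refine (Separated.sum_antitone_le τ.T_pos hx (τ.lcDemand_antitone t x) (τ.lcDemand_nonneg t x)
    (τ.lcDemand_le t x) (fun r h => τ.lcDemand_eq_zero h) R hsep hR).trans ?_
  have hk : (⌊x / τ.T⌋ : ℝ) * τ.T ≤ x := by
    rw [← le_div_iff₀ τ.T_pos]; exact Int.floor_le _
  unfold dbfA lcDemand dbfJobB
  have h0 : 0 ≤ min (x - (⌊x / τ.T⌋ : ℝ) * τ.T) τ.CL := le_min (by linarith) τ.CL_pos.le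
  rw [max_eq_right h0]

/-- If no job needs `C^H`, then condition b is the worst case, and a later switch is worse. -/
theorem sum_hcDemand_le_dbfB (τ : MCTask) {t x tE : ℝ} (hx : 0 ≤ x) (hxE : x ≤ tE)
    (R : Finset ℝ) (hsep : Separated τ.T R) (hR : ∀ r ∈ R, 0 ≤ r)
    (hno : ∀ r ∈ R, r + τ.D ≤ t → r + τ.DL < x) :
    ∑ r ∈ R, τ.hcDemand t x r ≤ τ.dbfB t tE := by
  set φ : ℝ → ℝ := fun r => if r + τ.DL < tE then τ.CL else τ.lcDemand t tE r with hφ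
  have h1 : ∑ r ∈ R, τ.hcDemand t x r ≤ ∑ r ∈ R, φ r := by
    refine Finset.sum_le_sum fun r hr => ?_
    simp only [hφ, hcDemand]
    split_ifs with h1 h2 h3 h4 h5
    · rfl
    · linarith
    · exact absurd (hno r hr h3) h1
    · exact absurd (hno r hr h3) h1
    · exact τ.lcDemand_le _ _ _
    · exact τ.lcDemand_mono _ _ hxE
  have hanti : Antitone φ := by
    intro r r' h
    simp only [hφ]
    split_ifs with h1 h2
    · rfl
    · linarith
    · exact τ.lcDemand_le _ _ _
    · exact τ.lcDemand_antitone _ _ h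
  have hE0 : 0 ≤ tE := hx.trans hxE
  have h2 := Separated.sum_antitone_le τ.T_pos hE0 hanti
    (fun r => by
      simp only [hφ]; split_ifs; exacts [τ.CL_pos.le, τ.lcDemand_nonneg _ _ _])
    (fun r => by
      simp only [hφ]; split_ifs; exacts [le_rfl, τ.lcDemand_le _ _ _])
    (fun r h => by
      have := τ.DL_pos
      simp only [hφ]
      rw [if_neg (by linarith), τ.lcDemand_eq_zero h]) R hsep hR
  refine h1.trans (h2.trans ?_)
  have hk : (⌊tE / τ.T⌋ : ℝ) * τ.T ≤ tE := by
    rw [← le_div_iff₀ τ.T_pos]; exact Int.floor_le _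
  have h0 : 0 ≤ min (tE - (⌊tE / τ.T⌋ : ℝ) * τ.T) τ.CL := le_min (by linarith) τ.CL_pos.le
  unfold dbfB
  gcongr
  -- `dbfJobA` differs from `φ` only in that it may count `C^H`
  simp only [hφ, dbfJobA]
  have hCLH := τ.CL_le_CH
  split_ifs with h3 h4 h5
  · rfl
  · exact (τ.lcDemand_le _ _ _).trans hCLH
  · rw [lcDemand, if_pos h5, max_eq_right h0]
  · rw [lcDemand, if_neg h5]

/-- For `t ≥ D` the pattern of condition c consists of `K + 1` jobs, the last one with deadline
`t`. Each of them counts with `C^L`, and each one that is not regarded as completed before the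
switch counts with an additional `C^H - C^L`. -/
theorem exists_dbfC_eq (τ : MCTask) {t : ℝ} (hD : τ.D ≤ t) :
    ∃ K : ℕ, τ.firstRelease t + K * τ.T + τ.D = t ∧ 0 ≤ τ.firstRelease t ∧
      τ.firstRelease t < τ.T ∧
      ∀ x, 0 ≤ x → x < t → τ.numBefore t x ≤ K ∧
        τ.dbfC t x = (K + 1) * τ.CL + ((K : ℝ) - τ.numBefore t x +
          (if τ.firstRelease t + τ.numBefore t x * τ.T + τ.DL < x then 0 else 1)) *
            (τ.CH - τ.CL) := by
  have hT := τ.T_pos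
  obtain ⟨K, hK⟩ := Int.eq_ofNat_of_zero_le
    (Int.floor_nonneg.2 (div_nonneg (sub_nonneg.2 hD) hT.le) : 0 ≤ ⌊(t - τ.D) / τ.T⌋)
  have hr0 : τ.firstRelease t = t - τ.D - K * τ.T := by
    unfold firstRelease; rw [hK]; simp
  have hlo : (K : ℝ) ≤ (t - τ.D) / τ.T := by
    have := Int.floor_le ((t - τ.D) / τ.T); rw [hK] at this; exact_mod_cast this
  have hhi : (t - τ.D) / τ.T < K + 1 := by
    have := Int.lt_floor_add_one ((t - τ.D) / τ.T); rw [hK] at this; exact_mod_cast this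
  rw [le_div_iff₀ hT] at hlo
  rw [div_lt_iff₀ hT] at hhi
  refine ⟨K, by linarith, by linarith, by linarith, fun x hx hxt => ?_⟩
  have hb : τ.numBefore t x ≤ K := by
    unfold numBefore
    rw [← Nat.lt_add_one_iff, Nat.floor_lt' (by omega), div_lt_iff₀ hT, hr0]
    push_cast
    linarith [τ.D_le]
  refine ⟨hb, ?_⟩
  have hb' : (τ.numBefore t x : ℝ) ≤ K := by exact_mod_cast hb
  have hfit : τ.firstRelease t + τ.numBefore t x * τ.T + τ.D ≤ t := by
    rw [hr0]; nlinarith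
  unfold dbfC dbfJobA
  rw [hK, if_pos hfit]
  push_cast
  split_ifs <;> ring

/-- In condition c an earlier switch is worse. -/
theorem dbfC_antitone (τ : MCTask) {t x tI : ℝ} (hD : τ.D ≤ t) (hI : 0 ≤ tI) (hIx : tI ≤ x)
    (hxt : x < t) : τ.dbfC t x ≤ τ.dbfC t tI := by
  obtain ⟨K, -, -, -, h⟩ := τ.exists_dbfC_eq hD
  rw [(h x (hI.trans hIx) hxt).2, (h tI hI (hIx.trans_lt hxt)).2]
  have hC := τ.CL_le_CH
  have hb : τ.numBefore t tI ≤ τ.numBefore t x := by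
    have := τ.T_pos
    unfold numBefore
    gcongr
  have hCC : 0 ≤ τ.CH - τ.CL := by linarith
  refine add_le_add le_rfl (mul_le_mul_of_nonneg_right ?_ hCC)
  rcases hb.lt_or_eq with hlt | heq
  · have : (τ.numBefore t tI : ℝ) + 1 ≤ τ.numBefore t x := by exact_mod_cast hlt
    split_ifs <;> linarith
  · rw [heq]
    split_ifs <;> linarith

/-- The pattern of condition c is the worst one as soon as all jobs with a positive demand have
their deadlines in the interval. If `D^L = T`, then condition c takes a job whose tightened deadline
is the instant `x` of the switch for completed; the hypothesis `hgen` excludes that coincidence. -/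
theorem sum_hcDemand_le_dbfC (τ : MCTask) {t x : ℝ} (hD : τ.D ≤ t) (hx : 0 ≤ x) (hxt : x < t)
    (hgen : ∀ n : ℤ, t - x ≠ n * τ.T)
    (R : Finset ℝ) (hsep : Separated τ.T R) (hR : ∀ r ∈ R, 0 ≤ r)
    (hzero : ∀ r ∈ R, t < r + τ.D → x ≤ r) :
    ∑ r ∈ R, τ.hcDemand t x r ≤ τ.dbfC t x := by
  have hT := τ.T_pos
  have hDT := τ.D_le
  have hDLD := τ.DL_le
  have hDL0 := τ.DL_pos
  obtain ⟨K, hK, hr0, hr0T, h⟩ := τ.exists_dbfC_eq hD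
  obtain ⟨hbK, hC⟩ := h x hx hxt
  rw [hC]
  -- `R'` are the jobs with a deadline in the interval, `Q` those among them that need `C^H`
  set R' := R.filter (fun r => r + τ.D ≤ t) with hR'
  have hsum : ∑ r ∈ R, τ.hcDemand t x r = ∑ r ∈ R', τ.hcDemand t x r := by
    rw [hR', Finset.sum_filter_of_ne]
    intro r hr hne
    by_contra hlt
    have hxr := hzero r hr (not_le.1 hlt)
    refine hne ?_
    rw [hcDemand, if_neg (by linarith), if_neg hlt, τ.lcDemand_eq_zero hxr]
  set Q := R'.filter (fun r => x ≤ r + τ.DL) with hQ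
  have hval : ∑ r ∈ R', τ.hcDemand t x r = R'.card * τ.CL + Q.card * (τ.CH - τ.CL) := by
    have : ∀ r ∈ R', τ.hcDemand t x r =
        τ.CL + (if x ≤ r + τ.DL then (τ.CH - τ.CL) else 0) := by
      intro r hr
      unfold hcDemand
      rw [if_pos (Finset.mem_filter.1 hr).2]
      by_cases hc : x ≤ r + τ.DL
      · rw [if_pos hc, if_neg (not_lt.2 hc)]; ring
      · rw [if_neg hc, if_pos (not_le.1 hc)]; ring
    rw [Finset.sum_congr rfl this, Finset.sum_add_distrib, ← Finset.sum_filter]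
    simp [hQ, mul_sub]
  rw [hsum, hval]
  have hsep' : Separated τ.T R' := hsep.mono (by exact_mod_cast Finset.filter_subset _ R)
  have hn : R'.card ≤ K + 1 := by
    rcases R'.eq_empty_or_nonempty with he | hne
    · simp [he]
    have := Separated.card_le (a := 0) (b := t - τ.D) R' hsep'
      (fun r hr => hR r (Finset.mem_filter.1 hr).1)
      (fun r hr => by linarith [(Finset.mem_filter.1 hr).2]) hne
    have h2 : ((R'.card : ℝ) - 1) * τ.T < (K + 1 : ℝ) * τ.T := by linarith
    have h3 := lt_of_mul_lt_mul_right h2 hT.le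
    have h4 : (R'.card : ℝ) < ((K + 2 : ℕ) : ℝ) := by push_cast; linarith
    have := Nat.cast_lt.1 h4
    omega
  have hQn : Q.card ≤ R'.card := Finset.card_filter_le _ _
  have hq : Q.Nonempty → ((Q.card : ℝ) - 1) * τ.T ≤ t - τ.D - (x - τ.DL) := fun hne =>
    Separated.card_le Q (hsep'.mono (by exact_mod_cast Finset.filter_subset _ R'))
      (fun r hr => by linarith [(Finset.mem_filter.1 hr).2])
      (fun r hr => by
        linarith [(Finset.mem_filter.1 (Finset.mem_filter.1 hr).1).2]) hne
  set b := τ.numBefore t x with hb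
  have hbx : b ≠ 0 → (b : ℝ) * τ.T ≤ x - τ.firstRelease t := by
    intro hb0
    rw [← le_div_iff₀ hT]
    exact (Nat.le_floor_iff' hb0).1 hb.le
  -- `Q` lies in `[x - D^L, t - D]`, which has no room for more than the jobs counted with `C^H`
  have hqH : (Q.card : ℝ) ≤ (K : ℝ) - b +
      (if τ.firstRelease t + b * τ.T + τ.DL < x then 0 else 1) := by
    obtain ⟨a, ha⟩ := Nat.exists_eq_add_of_le hbK
    have haR : (K : ℝ) = b + a := by exact_mod_cast ha
    rw [haR] at hK ⊢
    rcases Q.eq_empty_or_nonempty with he | hne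
    · simp only [he, Finset.card_empty, Nat.cast_zero]
      split_ifs <;> linarith [(Nat.cast_nonneg a : (0 : ℝ) ≤ a)]
    have hq := hq hne
    split_ifs with hlt
    · by_contra hcon
      have h1 : (a : ℝ) < Q.card := by linarith
      have h2 : (a : ℝ) + 1 ≤ Q.card := by exact_mod_cast h1
      nlinarith
    · by_contra hcon
      have h1 : ((a + 1 : ℕ) : ℝ) < Q.card := by push_cast; linarith
      have h2 : a + 1 < Q.card := by exact_mod_cast h1
      have h3 : (a : ℝ) + 2 ≤ Q.card := by exact_mod_cast h2
      have hb0 : b ≠ 0 := by omega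
      have hbx := hbx hb0
      have h4 : x ≤ τ.firstRelease t + b * τ.T + τ.DL - τ.T := by nlinarith
      apply hgen (a + 1)
      push_cast
      nlinarith
  have hCC : 0 ≤ τ.CH - τ.CL := by linarith [τ.CL_le_CH]
  have hnR : (R'.card : ℝ) ≤ K + 1 := by exact_mod_cast hn
  have := τ.CL_pos
  gcongr

/-- The demand of an HC task that switches between `tI` and `tE` is at most that for a switch at
one of these two instants. -/
theorem sum_hcDemand_le (τ : MCTask) (hcrit : τ.crit = Criticality.HC) {t x tI tE : ℝ}
    (hI : 0 ≤ tI) (hIx : tI ≤ x) (hxE : x ≤ tE) (hEt : tE ≤ t)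
    (hgen : ∀ n : ℤ, t - x ≠ n * τ.T)
    (R : Finset ℝ) (hsep : Separated τ.T R) (hR : ∀ r ∈ R, 0 ≤ r) :
    ∑ r ∈ R, τ.hcDemand t x r ≤ max (τ.dbf t tI) (τ.dbf t tE) := by
  have hDT := τ.D_le
  have hDLD := τ.DL_le
  have hDL0 := τ.DL_pos
  have hx : 0 ≤ x := hI.trans hIx
  have hxt : x < t := by
    refine lt_of_le_of_ne (hxE.trans hEt) fun h => hgen 0 ?_
    rw [h]; simp
  -- in the first case all jobs with a positive demand have their deadlines in the interval
  by_cases hcase : (∃ r ∈ R, r + τ.D ≤ t ∧ x ≤ r + τ.DL) ∨ τ.D ≤ t - x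
  · refine le_max_of_le_left ?_
    have hfacts : τ.D ≤ t ∧ τ.D - τ.DL ≤ t - x ∧ ∀ r ∈ R, t < r + τ.D → x ≤ r := by
      rcases hcase with ⟨r₁, hr₁, h1, h2⟩ | h
      · have := hR r₁ hr₁
        refine ⟨by linarith, by linarith, fun r hr hlt => ?_⟩
        have := hsep r₁ hr₁ r hr (by linarith)
        linarith
      · exact ⟨by linarith, by linarith, fun r _ hlt => by linarith⟩
    obtain ⟨hD, hreg, hzero⟩ := hfacts
    refine (τ.sum_hcDemand_le_dbfC hD hx hxt hgen R hsep hR hzero).trans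
      ((τ.dbfC_antitone hD hI hIx hxt).trans ?_)
    unfold dbf
    rw [hcrit]
    simp only
    rw [if_neg (by linarith)]
    split_ifs
    · rfl
    · exact le_max_right _ _
  · push Not at hcase
    obtain ⟨hno, hlt⟩ := hcase
    refine le_max_of_le_right ((τ.sum_hcDemand_le_dbfB hx hxE R hsep hR hno).trans ?_)
    unfold dbf
    rw [hcrit]
    simp only
    split_ifs
    · rfl
    · linarith
    · exact le_max_left _ _

/-! ### Linear bounds on the demand bound functions -/

theorem dbfJobA_le (τ : MCTask) (t ti r : ℝ) : τ.dbfJobA t ti r ≤ τ.CH := by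
  have := τ.CL_le_CH
  have := τ.CH_pos
  unfold dbfJobA
  split_ifs
  · assumption
  · rfl
  · exact (min_le_right _ _).trans ‹_›
  · exact this.le

theorem dbfA_le (τ : MCTask) (t ti : ℝ) : τ.dbfA t ti ≤ τ.CL / τ.T * ti + τ.CL := by
  have hJ : ∀ r, τ.dbfJobB t ti r ≤ τ.CL := by
    intro r
    unfold dbfJobB
    split_ifs
    · exact min_le_right _ _
    · exact τ.CL_pos.le
  have h1 := mul_le_mul_of_nonneg_right (Int.floor_le (ti / τ.T)) τ.CL_pos.le
  have h2 : τ.CL / τ.T * ti = ti / τ.T * τ.CL := by ring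
  unfold dbfA
  linarith [hJ ((⌊ti / τ.T⌋ : ℝ) * τ.T)]

/-- Before the switch the demand grows with slope `C^L / T`, after it with slope `C^H / T`. -/
def linearBound (τ : MCTask) (t ti : ℝ) : ℝ :=
  τ.CL / τ.T * ti + τ.CH / τ.T * (t - ti) + (2 * τ.T - τ.D) * (τ.CH / τ.T)

theorem linearBound_antitone (τ : MCTask) (t : ℝ) : Antitone (τ.linearBound t) := by
  intro a b hab
  have h : τ.CL / τ.T ≤ τ.CH / τ.T := by
    have := τ.T_pos; have := τ.CL_le_CH; gcongr
  unfold linearBound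
  nlinarith

theorem dbfB_le (τ : MCTask) {t ti : ℝ} (ht : ti ≤ t) : τ.dbfB t ti ≤ τ.linearBound t ti := by
  have hT := τ.T_pos
  have h1 := mul_le_mul_of_nonneg_right (Int.floor_le (ti / τ.T)) τ.CL_pos.le
  have h2 : τ.CL / τ.T * ti = ti / τ.T * τ.CL := by ring
  have h3 : 0 ≤ τ.CH / τ.T * (t - ti) :=
    mul_nonneg (div_nonneg τ.CH_pos.le hT.le) (by linarith)
  have h4 : τ.CH ≤ (2 * τ.T - τ.D) * (τ.CH / τ.T) := by
    have : τ.CH = τ.T * (τ.CH / τ.T) := by field_simp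
    conv_lhs => rw [this]
    have := τ.D_le
    have := τ.CH_pos
    gcongr
    linarith
  unfold dbfB linearBound
  linarith [τ.dbfJobA_le t ti ((⌊ti / τ.T⌋ : ℝ) * τ.T)]

theorem dbfC_le (τ : MCTask) {t ti : ℝ} : τ.dbfC t ti ≤ τ.linearBound t ti := by
  have hT := τ.T_pos
  set u := τ.CL / τ.T with hu
  set v := τ.CH / τ.T with hv
  have hCL : τ.CL = u * τ.T := by rw [hu]; field_simp
  have hCH : τ.CH = v * τ.T := by rw [hv]; field_simp
  have hu0 : 0 ≤ u := div_nonneg τ.CL_pos.le hT.le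
  have huv : u ≤ v := by
    have := τ.CL_le_CH
    rw [hu, hv]; gcongr
  have hfr : (⌊(t - τ.D) / τ.T⌋ : ℝ) * τ.T = t - τ.D - τ.firstRelease t := by
    unfold firstRelease; ring
  have hr0 : 0 ≤ τ.firstRelease t := by
    have h := Int.floor_le ((t - τ.D) / τ.T)
    rw [le_div_iff₀ hT] at h
    unfold firstRelease
    linarith
  have hb : ti - τ.firstRelease t ≤ (τ.numBefore t ti + 1 : ℝ) * τ.T := by
    rw [← div_le_iff₀ hT]
    exact (Nat.lt_floor_add_one _).le
  have hJ := τ.dbfJobA_le t ti (τ.firstRelease t + (τ.numBefore t ti : ℝ) * τ.T)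
  unfold dbfC linearBound
  rw [← hu, ← hv]
  set k := (⌊(t - τ.D) / τ.T⌋ : ℝ)
  set b := (τ.numBefore t ti : ℝ)
  rw [hCH] at hJ ⊢
  rw [hCL]
  have e1 : (k - b) * (v * τ.T) = v * (t - τ.D - τ.firstRelease t) - v * (b * τ.T) := by
    rw [← hfr]; ring
  rw [e1]
  nlinarith [mul_le_mul_of_nonneg_left hb (sub_nonneg.2 huv), mul_nonneg hu0 hr0,
    mul_nonneg hu0 hT.le]

theorem dbf_le_linearBound (τ : MCTask) (hcrit : τ.crit = Criticality.HC) {t ti : ℝ}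
    (ht : ti ≤ t) : τ.dbf t ti ≤ τ.linearBound t ti := by
  unfold dbf
  rw [hcrit]
  simp only
  split_ifs
  · exact τ.dbfB_le ht
  · exact τ.dbfC_le
  · exact max_le (τ.dbfB_le ht) τ.dbfC_le

end MCTask

/-! ### Demand of components and the test -/

namespace MCSystem

variable {κ ι : Type*}

theorem delta_nonneg (S : MCSystem κ ι) (t tE tI : ℝ) (i : ι) : 0 ≤ S.delta t tE tI i :=
  le_max_left _ _

theorem dbf_add_delta (S : MCSystem κ ι) (t tE tI : ℝ) (i : ι) :
    (S.task i).dbf t tE + S.delta t tE tI i =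
      max ((S.task i).dbf t tI) ((S.task i).dbf t tE) := by
  unfold delta
  rw [max_comm, ← max_add_add_left]
  simp

/-- A right neighbourhood of `t` contains an instant whose distance from `x i` is never a multiple
of `T i`. -/
theorem exists_generic [Countable ι] {t u : ℝ} (htu : t < u) (x T : ι → ℝ) :
    ∃ t', t < t' ∧ t' < u ∧ ∀ i, ∀ n : ℤ, t' - x i ≠ n * T i := by
  have hc : (⋃ i, Set.range fun n : ℤ => x i + n * T i).Countable :=
    Set.countable_iUnion fun i => Set.countable_range _
  obtain ⟨t', ht', h⟩ := (hc.dense_compl ℝ).exists_between htu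
  refine ⟨t', h.1, h.2, fun i n heq => ht' ?_⟩
  exact Set.mem_iUnion.2 ⟨i, n, by simp only; linarith⟩

theorem maxTwoTSubD_nonneg (S : MCSystem κ ι) (j : κ) : 0 ≤ S.maxTwoTSubD j :=
  Real.iSup_nonneg fun i => by
    have := (S.task i).D_le
    have := (S.task i).T_pos
    linarith

variable [Fintype ι]

theorem mem_lcTasks (S : MCSystem κ ι) {j : κ} {i : ι} :
    i ∈ S.lcTasks j ↔ S.comp i = j ∧ (S.task i).crit = Criticality.LC := by
  simp [lcTasks]

theorem mem_hcTasks (S : MCSystem κ ι) {j : κ} {i : ι} :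
    i ∈ S.hcTasks j ↔ S.comp i = j ∧ (S.task i).crit = Criticality.HC := by
  simp [hcTasks]

theorem le_maxTwoTSubD (S : MCSystem κ ι) {i : ι} {j : κ} (h : S.comp i = j) :
    2 * (S.task i).T - (S.task i).D ≤ S.maxTwoTSubD j :=
  le_ciSup (f := fun i : {i : ι // S.comp i = j} => 2 * (S.task i).T - (S.task i).D)
    (Set.finite_range _).bddAbove ⟨i, h⟩

theorem utilHH_nonneg (S : MCSystem κ ι) (j : κ) : 0 ≤ S.utilHH j :=
  Finset.sum_nonneg fun i _ => div_nonneg (S.task i).CH_pos.le (S.task i).T_pos.le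

/-- Up to a constant, the demand of a component grows with slope `U_L^L + U_H^L` before the
internal switch and with slope `U_H^H` after it. -/
theorem compDbf_le (S : MCSystem κ ι) (j : κ) {t tE tI : ℝ} (hI : 0 ≤ tI) (hIE : tI ≤ tE)
    (hEt : tE ≤ t) :
    S.compDbf j t tE tI ≤
      (if S.utilLL j + S.utilHL j - S.utilHH j < 0 then S.utilHH j
        else S.utilLL j + S.utilHL j) * t
      + (S.maxTwoTSubD j * S.utilHH j + ∑ i ∈ S.lcTasks j, (S.task i).CL) := by
  -- it suffices to compare with the linear bounds for some common switching instant `c`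
  have key : ∀ c, 0 ≤ c → c ≤ t → ∑ i ∈ S.hcTasks j, (S.task i).linearBound t c
      + ∑ i ∈ S.lcTasks j, (S.task i).dbf t c ≤
      (if S.utilLL j + S.utilHL j - S.utilHH j < 0 then S.utilHH j
        else S.utilLL j + S.utilHL j) * t
      + (S.maxTwoTSubD j * S.utilHH j + ∑ i ∈ S.lcTasks j, (S.task i).CL) := by
    intro c hc hct
    have h1 : ∑ i ∈ S.hcTasks j, (S.task i).linearBound t c ≤
        S.utilHL j * c + S.utilHH j * (t - c) + S.maxTwoTSubD j * S.utilHH j := by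
      unfold utilHL utilHH
      rw [Finset.sum_mul, Finset.sum_mul, Finset.mul_sum, ← Finset.sum_add_distrib,
        ← Finset.sum_add_distrib]
      refine Finset.sum_le_sum fun i hi => ?_
      unfold MCTask.linearBound
      have := S.le_maxTwoTSubD (S.mem_hcTasks.1 hi).1
      have := (S.task i).CH_pos
      have := (S.task i).T_pos
      gcongr
    have h2 : ∑ i ∈ S.lcTasks j, (S.task i).dbf t c ≤
        S.utilLL j * c + ∑ i ∈ S.lcTasks j, (S.task i).CL := by
      unfold utilLL
      rw [Finset.sum_mul, ← Finset.sum_add_distrib]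
      refine Finset.sum_le_sum fun i hi => ?_
      unfold MCTask.dbf
      rw [(S.mem_lcTasks.1 hi).2]
      exact (S.task i).dbfA_le t c
    split_ifs with h <;> nlinarith
  have hHC : ∀ i ∈ S.hcTasks j, ∀ {c}, c ≤ t → (S.task i).dbf t c ≤ (S.task i).linearBound t c :=
    fun i hi c hc => (S.task i).dbf_le_linearBound (S.mem_hcTasks.1 hi).2 hc
  rw [compDbf]
  by_cases hTL : S.TL j = 0
  · rw [if_pos hTL]
    refine le_trans ?_ (key tE (hI.trans hIE) hEt)
    gcongr with i hi
    exact hHC i hi hEt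
  · rw [if_neg hTL]
    refine le_trans ?_ (key tI hI (hIE.trans hEt))
    gcongr
    rw [← le_sub_iff_add_le']
    refine Finset.sup'_le _ _ fun G hG => ?_
    rw [le_sub_iff_add_le']
    have hGsub := Finset.mem_powerset.1 (Finset.mem_filter.1 hG).1
    calc ∑ i ∈ S.hcTasks j, (S.task i).dbf t tE + ∑ i ∈ G, S.delta t tE tI i
        ≤ ∑ i ∈ S.hcTasks j, (S.task i).dbf t tE + ∑ i ∈ S.hcTasks j, S.delta t tE tI i := by
          exact add_le_add le_rfl (Finset.sum_le_sum_of_subset_of_nonneg hGsub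
            fun i _ _ => S.delta_nonneg _ _ _ _)
      _ ≤ _ := by
          rw [← Finset.sum_add_distrib]
          refine Finset.sum_le_sum fun i hi => ?_
          rw [dbf_add_delta]
          exact max_le (hHC i hi (hIE.trans hEt))
            ((hHC i hi hEt).trans ((S.task i).linearBound_antitone t hIE))

variable [Fintype κ]

theorem sum_tasks (S : MCSystem κ ι) (f : ι → ℝ) :
    ∑ i, f i = ∑ j, (∑ i ∈ S.hcTasks j, f i + ∑ i ∈ S.lcTasks j, f i) := by
  classical
  rw [← Finset.sum_fiberwise Finset.univ S.comp f]
  refine Finset.sum_congr rfl fun j _ => ?_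
  rw [← Finset.sum_filter_add_sum_filter_not _ (fun i => (S.task i).crit = Criticality.HC)]
  congr 1
  · refine Finset.sum_congr ?_ fun _ _ => rfl
    ext i; simp [mem_hcTasks]
  · refine Finset.sum_congr ?_ fun _ _ => rfl
    ext i
    cases h : (S.task i).crit <;> simp [mem_lcTasks, h]

/-- Beyond `t_MAX` the inequality of the test holds automatically. -/
theorem PassesTest.sum_compDbf_le {S : MCSystem κ ι} (h : S.PassesTest) {t tE : ℝ} {tI : κ → ℝ}
    (hI : ∀ j, 0 ≤ tI j ∧ tI j ≤ tE) (hE : 0 ≤ tE) (hEt : tE ≤ t) :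
    ∑ j, S.compDbf j t tE (tI j) ≤ t := by
  by_cases hmax : (t : EReal) ≤ S.tMax
  · exact h t (hE.trans hEt) hmax tE hE hEt tI hI
  · unfold tMax at hmax
    split_ifs at hmax with hs
    · rw [EReal.coe_le_coe_iff, not_le, div_lt_iff₀ hs] at hmax
      have := Finset.sum_le_sum fun j (_ : j ∈ Finset.univ) =>
        S.compDbf_le j (hI j).1 (hI j).2 hEt
      rw [Finset.sum_add_distrib, ← Finset.sum_mul] at this
      unfold slack tMaxNum at hmax
      linarith
    · exact absurd le_top hmax

open Classical in
/-- The demand of a scenario that is compatible with the tolerance limits is bounded by the length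
of the interval: `J i` are the release instants of task `i`, and `x i` is the instant at which it
switches mode or is dropped. -/
theorem PassesTest.sum_demand_le {S : MCSystem κ ι} (h : S.PassesTest) {t tE : ℝ} {tI : κ → ℝ}
    (hI : ∀ j, 0 ≤ tI j ∧ tI j ≤ tE) (hE : 0 ≤ tE) (hEt : tE ≤ t) (x : ι → ℝ)
    (J : ι → Finset ℝ) (hJ : ∀ i, ∀ r ∈ J i, 0 ≤ r) (hsep : ∀ i, Separated (S.task i).T (J i))
    (hgen : ∀ i, ∀ n : ℤ, t - x i ≠ n * (S.task i).T)
    (hx0 : ∀ i, S.TL (S.comp i) = 0 → x i = tE)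
    (hxLC : ∀ i, (S.task i).crit = Criticality.LC → S.TL (S.comp i) ≠ 0 → x i = tI (S.comp i))
    (hxHC : ∀ i, (S.task i).crit = Criticality.HC → tI (S.comp i) ≤ x i ∧ x i ≤ tE)
    (hTL : ∀ j, S.TL j ≠ 0 → ((S.hcTasks j).filter (fun i => x i ≠ tE)).card ≤ S.TL j) :
    ∑ i, ∑ r ∈ J i, (S.task i).demand t (x i) r ≤ t := by
  refine le_trans ?_ (h.sum_compDbf_le hI hE hEt)
  rw [S.sum_tasks]
  refine Finset.sum_le_sum fun j _ => ?_
  have hLC : ∀ i ∈ S.lcTasks j, 0 ≤ x i →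
      ∑ r ∈ J i, (S.task i).demand t (x i) r ≤ (S.task i).dbf t (x i) := by
    intro i hi hxi
    unfold MCTask.demand MCTask.dbf
    rw [(S.mem_lcTasks.1 hi).2]
    exact (S.task i).sum_lcDemand_le hxi (J i) (hsep i) (hJ i)
  have hHC : ∀ i ∈ S.hcTasks j, ∀ c, 0 ≤ c → c ≤ x i → x i ≤ tE →
      ∑ r ∈ J i, (S.task i).demand t (x i) r ≤
        max ((S.task i).dbf t c) ((S.task i).dbf t tE) := by
    intro i hi c hc0 hc hE
    unfold MCTask.demand
    rw [(S.mem_hcTasks.1 hi).2]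
    exact (S.task i).sum_hcDemand_le (S.mem_hcTasks.1 hi).2 hc0 hc hE hEt (hgen i) (J i)
      (hsep i) (hJ i)
  unfold compDbf
  split_ifs with hj
  · refine add_le_add (Finset.sum_le_sum fun i hi => ?_) (Finset.sum_le_sum fun i hi => ?_)
    · have hxi := hx0 i ((S.mem_hcTasks.1 hi).1 ▸ hj)
      simpa using hHC i hi tE hE hxi.ge hxi.le
    · have hxi := hx0 i ((S.mem_lcTasks.1 hi).1 ▸ hj)
      have := hLC i hi (hxi ▸ hE)
      rwa [hxi] at this ⊢
  · refine add_le_add ?_ (Finset.sum_le_sum fun i hi => ?_)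
    · set G := (S.hcTasks j).filter (fun i => x i ≠ tE) with hG
      have hGle : ∑ i ∈ G, S.delta t tE (tI j) i ≤ S.deltaSum j t tE (tI j) := by
        unfold deltaSum
        refine Finset.le_sup' (fun G => ∑ i ∈ G, S.delta t tE (tI j) i) ?_
        rw [Finset.mem_filter, Finset.mem_powerset]
        exact ⟨Finset.filter_subset _ _, hTL j hj⟩
      refine le_trans ?_ (add_le_add le_rfl hGle)
      rw [hG, Finset.sum_filter, ← Finset.sum_add_distrib]
      refine Finset.sum_le_sum fun i hi => ?_
      obtain ⟨hc, hcrit⟩ := S.mem_hcTasks.1 hi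
      have hxi := hxHC i hcrit
      rw [hc] at hxi
      split_ifs with hne
      · rw [dbf_add_delta]
        exact hHC i hi (tI j) (hI j).1 hxi.1 hxi.2
      · rw [not_ne_iff] at hne
        simpa using hHC i hi tE hE hne.ge hne.le
    · obtain ⟨hc, hcrit⟩ := S.mem_lcTasks.1 hi
      have hxi := hxLC i hcrit (hc ▸ hj)
      rw [hc] at hxi
      have := hLC i hi (hxi ▸ (hI j).1)
      rwa [hxi] at this ⊢

/-- The test implies that the LC WCET of an HC task fits into its tightened deadline. -/
theorem PassesTest.CL_le_DL {S : MCSystem κ ι} (h : S.PassesTest) (i : ι)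
    (hi : (S.task i).crit = Criticality.HC) : (S.task i).CL ≤ (S.task i).DL := by
  classical
  by_contra! hlt
  obtain ⟨tE, h1, h2⟩ := exists_between hlt
  obtain ⟨t, h3, h4, hgen⟩ := exists_generic h2 (fun _ : ι => tE) (fun i => (S.task i).T)
  have h0 := (S.task i).DL_pos
  have hE : 0 ≤ tE := by linarith
  have := h.sum_demand_le (t := t) (tE := tE) (tI := fun _ => tE) (fun _ => ⟨hE, le_rfl⟩) hE h3.le
    (fun _ => tE) (fun k => if k = i then {0} else ∅)
    (fun k r hr => by split_ifs at hr <;> simp_all)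
    (fun k r hr r' hr' hrr => by
      split_ifs at hr hr'
      · simp at hr hr'; linarith
      · simp at hr)
    hgen (fun _ _ => rfl) (fun _ _ _ => rfl) (fun _ _ => ⟨le_rfl, le_rfl⟩) (fun j _ => by simp)
  rw [Finset.sum_eq_single i (fun k _ hk => by simp [hk]) (by simp)] at this
  rw [if_pos rfl, Finset.sum_singleton, MCTask.demand, hi] at this
  simp only [MCTask.hcDemand] at this
  rw [if_pos (by linarith)] at this
  linarith

/-! ### The size of `t_MAX` -/

theorem tMaxNum_le (S : MCSystem κ ι) (hS : S.Integral) :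
    S.tMaxNum ≤ 2 * S.unarySize ^ 2 + S.unarySize := by
  have hT1 : ∀ i, 1 ≤ (S.task i).T := by
    intro i
    obtain ⟨T, -, -, -, -, hT, -⟩ := hS i
    have := (S.task i).T_pos
    rw [hT] at this ⊢
    exact_mod_cast this
  have hpar : ∀ i, 0 ≤ (S.task i).T + (S.task i).CL + (S.task i).CH + (S.task i).D
      + (S.task i).DL := fun i => by
    linarith [(S.task i).T_pos, (S.task i).CL_pos, (S.task i).CH_pos, (S.task i).D_pos,
      (S.task i).DL_pos]
  have hrest : (0 : ℝ) ≤ Fintype.card κ + Fintype.card ι + ∑ j, (S.TL j : ℝ) := by positivity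
  have hsum : ∑ i, ((S.task i).CL + (S.task i).CH) ≤ S.unarySize := by
    have : ∑ i, ((S.task i).CL + (S.task i).CH) ≤
        ∑ i, ((S.task i).T + (S.task i).CL + (S.task i).CH + (S.task i).D + (S.task i).DL) :=
      Finset.sum_le_sum fun i _ => by
        linarith [(S.task i).T_pos, (S.task i).D_pos, (S.task i).DL_pos]
    unfold unarySize
    linarith
  have hN0 : 0 ≤ S.unarySize := (Finset.sum_nonneg fun i _ => by
    linarith [(S.task i).CL_pos, (S.task i).CH_pos]).trans hsum
  have hTN : ∀ i, (S.task i).T ≤ S.unarySize := by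
    intro i
    have := Finset.single_le_sum (fun i _ => hpar i) (Finset.mem_univ i)
    unfold unarySize
    linarith [(S.task i).CL_pos, (S.task i).CH_pos, (S.task i).D_pos, (S.task i).DL_pos]
  have hmax : ∀ j, S.maxTwoTSubD j ≤ 2 * S.unarySize := fun j =>
    Real.iSup_le (fun i => by linarith [hTN i, (S.task i).D_pos]) (by linarith)
  have hHH : ∀ j, S.utilHH j ≤ ∑ i ∈ S.hcTasks j, (S.task i).CH := fun j =>
    Finset.sum_le_sum fun i _ => div_le_self (S.task i).CH_pos.le (hT1 i)
  have hCH : ∑ j, ∑ i ∈ S.hcTasks j, (S.task i).CH ≤ S.unarySize := by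
    refine le_trans ?_ hsum
    rw [S.sum_tasks]
    refine Finset.sum_le_sum fun j _ => ?_
    have h1 : ∑ i ∈ S.hcTasks j, (S.task i).CH ≤
        ∑ i ∈ S.hcTasks j, ((S.task i).CL + (S.task i).CH) :=
      Finset.sum_le_sum fun i _ => by linarith [(S.task i).CL_pos]
    have h2 : 0 ≤ ∑ i ∈ S.lcTasks j, ((S.task i).CL + (S.task i).CH) :=
      Finset.sum_nonneg fun i _ => by linarith [(S.task i).CL_pos, (S.task i).CH_pos]
    linarith
  have hCL : ∑ j, ∑ i ∈ S.lcTasks j, (S.task i).CL ≤ S.unarySize := by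
    refine le_trans ?_ hsum
    rw [S.sum_tasks]
    refine Finset.sum_le_sum fun j _ => ?_
    have h1 : ∑ i ∈ S.lcTasks j, (S.task i).CL ≤
        ∑ i ∈ S.lcTasks j, ((S.task i).CL + (S.task i).CH) :=
      Finset.sum_le_sum fun i _ => by linarith [(S.task i).CH_pos]
    have h2 : 0 ≤ ∑ i ∈ S.hcTasks j, ((S.task i).CL + (S.task i).CH) :=
      Finset.sum_nonneg fun i _ => by linarith [(S.task i).CL_pos, (S.task i).CH_pos]
    linarith
  unfold tMaxNum
  rw [Finset.sum_add_distrib]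
  have : ∑ j, S.maxTwoTSubD j * S.utilHH j ≤ 2 * S.unarySize * S.unarySize := by
    calc ∑ j, S.maxTwoTSubD j * S.utilHH j
        ≤ ∑ j, 2 * S.unarySize * ∑ i ∈ S.hcTasks j, (S.task i).CH :=
          Finset.sum_le_sum fun j _ =>
            mul_le_mul (hmax j) (hHH j) (S.utilHH_nonneg j) (by linarith)
      _ ≤ 2 * S.unarySize * S.unarySize := by
          rw [← Finset.mul_sum]
          exact mul_le_mul_of_nonneg_left hCH (by linarith)
  linarith

theorem tMax_le (S : MCSystem κ ι) (hS : S.Integral) {ε : ℝ} (hε : 0 < ε) (hs : ε ≤ S.slack) :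
    S.tMax ≤ (((2 * S.unarySize ^ 2 + S.unarySize) / ε : ℝ) : EReal) := by
  have hpos := hε.trans_le hs
  rw [tMax, if_pos hpos, EReal.coe_le_coe_iff]
  have hN0 : 0 ≤ S.tMaxNum := Finset.sum_nonneg fun j _ =>
    add_nonneg (mul_nonneg (S.maxTwoTSubD_nonneg j) (S.utilHH_nonneg j))
      (Finset.sum_nonneg fun i _ => (S.task i).CL_pos.le)
  exact div_le_div₀ (hN0.trans (S.tMaxNum_le hS)) (S.tMaxNum_le hS) hε hs

end MCSystem

/-! ### Switching points -/

/-- A predicate that stays true once it is true has a switching point in `[s,d]`. -/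
theorem exists_switch {s d : ℝ} (hsd : s ≤ d) (P : ℝ → Prop)
    (hP : ∀ x y, s ≤ x → x ≤ y → y < d → P x → P y) :
    ∃ x, s ≤ x ∧ x ≤ d ∧ (∀ y, s ≤ y → y < x → ¬ P y) ∧ (∀ y, x < y → y < d → P y) := by
  set A : Set ℝ := insert d {y | s ≤ y ∧ y < d ∧ P y} with hA
  have hne : A.Nonempty := ⟨d, Set.mem_insert _ _⟩
  have hlb : ∀ y ∈ A, s ≤ y := by
    rintro y (rfl | hy)
    exacts [hsd, hy.1]
  have hbdd : BddBelow A := ⟨s, hlb⟩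
  have hd : sInf A ≤ d := csInf_le hbdd (Set.mem_insert _ _)
  refine ⟨sInf A, le_csInf hne hlb, hd, fun y hsy hy hPy => ?_, fun y hy hyd => ?_⟩
  · exact not_lt.2 (csInf_le hbdd (Or.inr ⟨hsy, hy.trans_le hd, hPy⟩)) hy
  · obtain ⟨z, hz, hzy⟩ := exists_lt_of_csInf_lt hne hy
    rcases hz with rfl | ⟨h1, -, h3⟩
    · linarith
    · exact hP z y h1 hzy.le hyd h3

namespace Run

variable {κ ι : Type*} {S : MCSystem κ ι} {R : Run κ ι}

/-! ### Service received by a job -/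

theorem servedSet_ne_top (R : Run κ ι) (i : ι) (r x : ℝ) :
    volume {y : ℝ | 0 ≤ y ∧ y < x ∧ R.proc y = some (i, r)} ≠ ⊤ := by
  refine ((measure_mono (t := Set.Ico 0 x) fun y hy => ⟨hy.1, hy.2.1⟩).trans_lt ?_).ne
  simp

theorem served_nonneg (R : Run κ ι) (i : ι) (r x : ℝ) : 0 ≤ R.served i r x :=
  ENNReal.toReal_nonneg

theorem served_mono (R : Run κ ι) (i : ι) (r : ℝ) : Monotone (R.served i r) := fun _ y h =>
  ENNReal.toReal_mono (R.servedSet_ne_top i r y)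
    (measure_mono fun _ hz => ⟨hz.1, hz.2.1.trans_le h, hz.2.2⟩)

theorem served_le_add (R : Run κ ι) (i : ι) (r : ℝ) {x y : ℝ} (h : x ≤ y) :
    R.served i r y ≤ R.served i r x + (y - x) := by
  unfold served
  rw [← ENNReal.toReal_ofReal (sub_nonneg.2 h),
    ← ENNReal.toReal_add (R.servedSet_ne_top i r x) ENNReal.ofReal_ne_top]
  refine ENNReal.toReal_mono
    (ENNReal.add_ne_top.2 ⟨R.servedSet_ne_top i r x, ENNReal.ofReal_ne_top⟩) ?_
  rw [← Real.volume_Ico]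
  refine (measure_mono ?_).trans (measure_union_le _ _)
  intro z hz
  rcases lt_or_ge z x with h | h
  · exact Or.inl ⟨hz.1, h, hz.2.2⟩
  · exact Or.inr ⟨h, hz.2.1⟩

theorem continuous_served (R : Run κ ι) (i : ι) (r : ℝ) : Continuous (R.served i r) := by
  refine (LipschitzWith.of_dist_le_mul (K := 1) fun x y => ?_).continuous
  rw [Real.dist_eq, Real.dist_eq, NNReal.coe_one, one_mul]
  rcases le_total x y with h | h
  · rw [abs_sub_comm, abs_sub_comm x y, abs_of_nonneg (sub_nonneg.2 (R.served_mono i r h)),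
      abs_of_nonneg (sub_nonneg.2 h)]
    linarith [R.served_le_add i r h]
  · rw [abs_of_nonneg (sub_nonneg.2 (R.served_mono i r h)), abs_of_nonneg (sub_nonneg.2 h)]
    linarith [R.served_le_add i r h]

theorem served_eq_zero_of_nonpos (R : Run κ ι) (i : ι) (r : ℝ) {x : ℝ} (hx : x ≤ 0) :
    R.served i r x = 0 := by
  have : {y : ℝ | 0 ≤ y ∧ y < x ∧ R.proc y = some (i, r)} = ∅ := by
    refine Set.eq_empty_of_forall_notMem fun y hy => ?_
    linarith [hy.1, hy.2.1]
  rw [served, this]; simp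

/-- A job that is executed only while its service is at most `c` never receives more than `c`. -/
theorem served_le_of_proc {i : ι} {r x c : ℝ} (hc : 0 ≤ c)
    (h : ∀ y, 0 ≤ y → y < x → R.proc y = some (i, r) → R.served i r y ≤ c) :
    R.served i r x ≤ c := by
  by_contra! hlt
  have hx : 0 ≤ x := by
    by_contra! hx
    rw [R.served_eq_zero_of_nonpos i r hx.le] at hlt
    linarith
  have h0 : R.served i r 0 = 0 := R.served_eq_zero_of_nonpos i r le_rfl
  obtain ⟨m, hm1, hm2⟩ := exists_between hlt
  obtain ⟨z, -, hz⟩ := intermediate_value_Icc hx (R.continuous_served i r).continuousOn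
    (show m ∈ Set.Icc _ _ from ⟨by rw [h0]; linarith, hm2.le⟩)
  have : R.served i r x ≤ R.served i r z := by
    refine ENNReal.toReal_mono (R.servedSet_ne_top i r z) (measure_mono fun y hy => ?_)
    refine ⟨hy.1, ?_, hy.2.2⟩
    by_contra! hzy
    linarith [h y hy.1 hy.2.1 hy.2.2, R.served_mono i r hzy]
  linarith

theorem Legal.pending_of_proc (hR : R.Legal S) {i : ι} {r y : ℝ} (hy : 0 ≤ y)
    (h : R.proc y = some (i, r)) : R.Pending S i r y :=
  (hR.edf y hy i r h).1

theorem Legal.served_le_exec (hR : R.Legal S) {i : ι} {r : ℝ} (hr : r ∈ R.rel i) (x : ℝ) :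
    R.served i r x ≤ R.exec i r :=
  served_le_of_proc (hR.exec_nonneg i r hr) fun _ hy _ hp => (hR.pending_of_proc hy hp).2.2.1.le

theorem Legal.served_eq_zero (hR : R.Legal S) {i : ι} {r x : ℝ} (hx : x ≤ r) :
    R.served i r x = 0 :=
  le_antisymm (served_le_of_proc le_rfl fun _ hy hyx hp =>
    absurd (hR.pending_of_proc hy hp).2.1 (by linarith)) (R.served_nonneg i r x)

theorem Pending.mono {i : ι} {r x y : ℝ} (h : R.Pending S i r y) (hr : r ≤ x) (hxy : x ≤ y) :
    R.Pending S i r x :=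
  ⟨h.1, hr, (R.served_mono i r hxy).trans_lt h.2.2.1, fun z h1 h2 => h.2.2.2 z h1 (h2.trans hxy)⟩

/-! ### Modes do not fall without a reset -/

/-- No component switches its modes back to LC in `(x,y]`. -/
def NoReset (R : Run κ ι) (x y : ℝ) : Prop :=
  ∀ j, ∀ z ∈ R.reset j, ¬ (x < z ∧ z ≤ y)

theorem Overrun.mono {i : ι} {x y : ℝ} (h : R.Overrun S i x) (hxy : x ≤ y)
    (hno : R.NoReset x y) : R.Overrun S i y := by
  obtain ⟨r, hr, hrx, h1, h2, h3⟩ := h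
  refine ⟨r, hr, hrx.trans hxy, h1, h2.trans (R.served_mono i r hxy), fun z hz hzr => ?_⟩
  rcases le_or_gt z x with h | h
  · exact h3 z hz ⟨hzr.1, h⟩
  · exact hno _ z hz ⟨h, hzr.2⟩

theorem InternalHC.mono {j : κ} {x y : ℝ} (h : R.InternalHC S j x) (hxy : x ≤ y)
    (hno : R.NoReset x y) : R.InternalHC S j y := by
  obtain ⟨i, h1, h2, h3⟩ := h
  exact ⟨i, h1, h2, h3.mono hxy hno⟩

theorem SystemHC.mono [Finite ι] {x y : ℝ} (h : R.SystemHC S x) (hxy : x ≤ y)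
    (hno : R.NoReset x y) : R.SystemHC S y := by
  obtain ⟨j, hj⟩ := h
  exact ⟨j, lt_of_lt_of_le hj (Set.ncard_le_ncard
    (fun i hi => ⟨hi.1, hi.2.1, hi.2.2.mono hxy hno⟩) (Set.toFinite _))⟩

theorem TaskHC.mono [Finite ι] {i : ι} {x y : ℝ} (h : R.TaskHC S i x) (hxy : x ≤ y)
    (hno : R.NoReset x y) : R.TaskHC S i y :=
  ⟨h.1, h.2.imp (fun h => h.mono hxy hno) (fun h => h.mono hxy hno)⟩

theorem deadline_mono [Finite ι] {i : ι} {r x y : ℝ} (hxy : x ≤ y) (hno : R.NoReset x y) :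
    R.deadline S i r x ≤ R.deadline S i r y := by
  unfold deadline
  have := (S.task i).DL_le
  split_ifs with h1 h2
  · rfl
  · exact absurd (h1.mono hxy hno) h2
  · linarith
  · rfl

theorem le_deadline (i : ι) (r x : ℝ) : r + (S.task i).DL ≤ R.deadline S i r x := by
  unfold deadline
  have := (S.task i).DL_le
  split_ifs <;> linarith

theorem deadline_le (i : ι) (r x : ℝ) : R.deadline S i r x ≤ r + (S.task i).D := by
  unfold deadline
  have := (S.task i).DL_le
  split_ifs <;> linarith

theorem Legal.noReset_of_pending (hR : R.Legal S) {i : ι} {r x y : ℝ} (hrx : r ≤ x)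
    (h : R.Pending S i r y) : R.NoReset x y := fun j z hz hzx =>
  hR.reset_idle j z hz i r h.1 (hrx.trans_lt hzx.1)
    (h.mono (hrx.trans hzx.1.le) hzx.2)

theorem internalHC_of_overrun {i : ι} {x : ℝ} (hi : (S.task i).crit = Criticality.HC)
    (h : R.Overrun S i x) : R.InternalHC S (S.comp i) x := ⟨i, rfl, hi, h⟩

theorem InternalHC.systemHC [Finite ι] {j : κ} {x : ℝ} (h : R.InternalHC S j x)
    (hj : S.TL j = 0) : R.SystemHC S x := by
  obtain ⟨i, h1, h2, h3⟩ := h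
  refine ⟨j, ?_⟩
  rw [ExternalHC, hj, Set.ncard_pos (Set.toFinite _)]
  exact ⟨i, h1, h2, h3⟩

/-! ### Service is bounded by demand -/

/-- At time `y` an HC task `i` is in HC mode, or the jobs of an LC task `i` are dropped. -/
def Switched (S : MCSystem κ ι) (R : Run κ ι) (i : ι) (y : ℝ) : Prop :=
  R.TaskHC S i y ∨ R.Drops S i y

theorem switched_hc {i : ι} {y : ℝ} (hi : (S.task i).crit = Criticality.HC) :
    R.Switched S i y ↔ R.Overrun S i y ∨ R.SystemHC S y := by
  simp [Switched, TaskHC, Drops, hi]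

theorem switched_lc {i : ι} {y : ℝ} (hi : (S.task i).crit = Criticality.LC) :
    R.Switched S i y ↔ R.InternalHC S (S.comp i) y ∨ R.SystemHC S y := by
  simp [Switched, TaskHC, Drops, hi]

/-- The tightened requirement of the job of the HC task `i` released at `r`. -/
def MeetsTightened (S : MCSystem κ ι) (R : Run κ ι) (i : ι) (r : ℝ) : Prop :=
  (∀ y, r ≤ y → y < r + (S.task i).DL → ¬ R.TaskHC S i y) →
    min (R.exec i r) (S.task i).CL ≤ R.served i r (r + (S.task i).DL)

/-- A job whose tightened deadline precedes the switch of its task needs at most `C^L`; otherwise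
it would have overrun by then. -/
theorem exec_le_CL {i : ι} {r x : ℝ} (hi : (S.task i).crit = Criticality.HC) (hr : r ∈ R.rel i)
    (htight : R.MeetsTightened S i r) (hrx : r + (S.task i).DL < x)
    (hbefore : ∀ y, r ≤ y → y < x → ¬ R.Switched S i y)
    (hno : R.NoReset r (r + (S.task i).DL)) : R.exec i r ≤ (S.task i).CL := by
  by_contra! hlt
  have h0 := (S.task i).DL_pos
  have h := htight fun y h1 h2 h3 => hbefore y h1 (h2.trans hrx) (Or.inl h3)
  rw [min_eq_right hlt.le] at h
  exact hbefore _ (by linarith) hrx ((switched_hc hi).2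
    (Or.inl ⟨r, hr, by linarith, hlt, h, fun z hz => hno _ z hz⟩))

theorem Legal.served_le_lcDemand (hR : R.Legal S) {i : ι} {r x d t : ℝ}
    (h : ∀ y, r < y → y < d → R.proc y = some (i, r) →
      y ≤ x ∧ r + (S.task i).DL ≤ t ∧ R.served i r y ≤ (S.task i).CL) :
    R.served i r d ≤ (S.task i).lcDemand t x r := by
  have hCL := (S.task i).CL_pos
  have hcase : ∀ y, 0 ≤ y → R.proc y = some (i, r) → y = r ∨ r < y := fun y hy hp =>
    (hR.pending_of_proc hy hp).2.1.eq_or_lt.imp Eq.symm id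
  unfold MCTask.lcDemand
  split_ifs with ht
  · rw [max_min_distrib_left, max_eq_right hCL.le]
    refine le_min ?_ (served_le_of_proc hCL.le fun y hy hyd hp => ?_)
    · have hsub : {y : ℝ | 0 ≤ y ∧ y < d ∧ R.proc y = some (i, r)} ⊆ Set.Icc r x ∪ {r} := by
        rintro y ⟨hy, hyd, hp⟩
        rcases hcase y hy hp with rfl | hlt
        · exact Or.inr rfl
        · exact Or.inl ⟨hlt.le, (h y hlt hyd hp).1⟩
      have hle := (measure_mono hsub).trans (measure_union_le (μ := volume) _ _)
      rw [Real.volume_Icc, Real.volume_singleton, add_zero] at hle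
      have := ENNReal.toReal_mono ENNReal.ofReal_ne_top hle
      rw [ENNReal.toReal_ofReal', max_comm] at this
      exact this
    · rcases hcase y hy hp with rfl | hlt
      · rw [hR.served_eq_zero le_rfl]; exact hCL.le
      · exact (h y hlt hyd hp).2.2
  · refine served_le_of_proc le_rfl fun y hy hyd hp => ?_
    rcases hcase y hy hp with rfl | hlt
    · rw [hR.served_eq_zero le_rfl]
    · exact absurd (h y hlt hyd hp).2.1 ht

/-- A job that is executed up to `d` only when its deadline is at most `d` receives no more service
than its demand for an interval that ends at some `t > d`. -/
theorem Legal.served_le_demand (hR : R.Legal S) {i : ι} {r x d t : ℝ} (hr : r ∈ R.rel i)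
    (hxd : x ≤ d) (hdt : d < t)
    (hexec : ∀ y, r < y → y < d → R.proc y = some (i, r) → R.deadline S i r y ≤ d)
    (hno : ∀ y, y < d → R.NoReset r y)
    (hbefore : ∀ y, r ≤ y → y < x → ¬ R.Switched S i y)
    (hafter : ∀ y, r ≤ y → x < y → y < d → R.Switched S i y)
    (htight : (S.task i).crit = Criticality.HC → r + (S.task i).DL < d →
      R.MeetsTightened S i r) :
    R.served i r d ≤ (S.task i).demand t x r := by
  unfold MCTask.demand
  have hr0 := hR.rel_nonneg i r hr
  cases hi : (S.task i).crit
  · refine hR.served_le_lcDemand fun y hry hyd hp => ⟨?_, ?_, ?_⟩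
    · by_contra! hxy
      rcases hafter y hry.le hxy hyd with h | h
      · rw [h.1] at hi; cases hi
      · exact (hR.pending_of_proc (hr0.trans hry.le) hp).2.2.2 y hry.le le_rfl h
    · linarith [hexec y hry hyd hp, le_deadline (S := S) (R := R) i r y]
    · rw [(S.task i).lc_wcet hi]
      exact (hR.served_le_exec hr y).trans (hR.exec_le i r hr)
  · simp only [MCTask.hcDemand]
    split_ifs with h1 h2
    · exact (hR.served_le_exec hr d).trans (exec_le_CL hi hr (htight hi (by linarith)) h1 hbefore
        (hno _ (by linarith)))
    · exact (hR.served_le_exec hr d).trans (hR.exec_le i r hr)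
    · refine hR.served_le_lcDemand fun y hry hyd hp => ?_
      have hdl := hexec y hry hyd hp
      have hnot : ¬ R.TaskHC S i y := by
        intro h
        rw [deadline, if_pos h] at hdl
        linarith
      refine ⟨?_, ?_, ?_⟩
      · by_contra! hxy
        rcases hafter y hry.le hxy hyd with h | h
        · exact hnot h
        · rw [h.1] at hi; cases hi
      · linarith [le_deadline (S := S) (R := R) i r y]
      · by_contra! hlt
        exact hnot ⟨hi, Or.inl ⟨r, hr, hry.le, hlt.trans_le (hR.served_le_exec hr y), hlt.le,
          fun z hz => hno y hyd _ z hz⟩⟩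

/-! ### The busy interval before a missed deadline -/

/-- If some job is pending with a deadline at most `d` from `r₀` up to `d`, then there is an
instant `s ≤ r₀` from which on up to `d` the processor works only for jobs that are released at or
after `s` and have a deadline at most `d`, and no modes are reset. It is the last instant up to `r₀`
at which no job released earlier is pending with a deadline at most `d`. -/
theorem Legal.exists_busy_start [Finite ι] (hR : R.Legal S) {i₀ : ι} {r₀ d : ℝ}
    (hr₀ : r₀ ∈ R.rel i₀)
    (hbusy : ∀ x, r₀ ≤ x → x < d → R.Pending S i₀ r₀ x ∧ R.deadline S i₀ r₀ x ≤ d) :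
    ∃ s, 0 ≤ s ∧ s ≤ r₀ ∧ (∀ y, y < d → R.NoReset s y) ∧
      ∀ y, s < y → y < d → ∃ i r, R.proc y = some (i, r) ∧ s ≤ r ∧
        r ∈ R.rel i ∧ r ≤ y ∧ R.deadline S i r y ≤ d := by
  set Z : Set ℝ := {x | 0 ≤ x ∧ x ≤ r₀ ∧
    ∀ i r, r < x → R.Pending S i r x → d < R.deadline S i r x} with hZ
  have h0 : (0 : ℝ) ∈ Z := ⟨le_rfl, hR.rel_nonneg _ _ hr₀, fun i r hr hp =>
    absurd (hR.rel_nonneg _ _ hp.1) (not_le.2 hr)⟩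
  have hbdd : BddAbove Z := ⟨r₀, fun x hx => hx.2.1⟩
  set s := sSup Z with hs
  have hs0 : 0 ≤ s := le_csSup hbdd h0
  have hsr : s ≤ r₀ := csSup_le ⟨0, h0⟩ fun x hx => hx.2.1
  have hsZ : ∀ i r, r < s → R.Pending S i r s → d < R.deadline S i r s := by
    intro i r hr hp
    obtain ⟨x, hx, hrx⟩ := exists_lt_of_lt_csSup ⟨0, h0⟩ hr
    have hxs : x ≤ s := le_csSup hbdd hx
    exact (hx.2.2 i r hrx (hp.mono hrx.le hxs)).trans_le
      (deadline_mono hxs (hR.noReset_of_pending hrx.le hp))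
  have hw : ∀ x, s < x → x < d → ∃ i r, r < x ∧ R.Pending S i r x ∧ R.deadline S i r x ≤ d := by
    intro x hsx hxd
    rcases le_or_gt x r₀ with h | h
    · by_contra! hcon
      exact not_le.2 hsx (le_csSup hbdd ⟨hs0.trans hsx.le, h, hcon⟩)
    · exact ⟨i₀, r₀, h, hbusy x h.le hxd⟩
  have hno : ∀ y, y < d → R.NoReset s y := by
    intro y hyd j z hz hzs
    obtain ⟨i, r, hr, hp, -⟩ := hw z hzs.1 (hzs.2.trans_lt hyd)
    exact hR.reset_idle j z hz i r hp.1 hr hp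
  refine ⟨s, hs0, hsr, hno, fun y hsy hyd => ?_⟩
  obtain ⟨i', r', -, hp', hd'⟩ := hw y hsy hyd
  have hy0 : 0 ≤ y := hs0.trans hsy.le
  cases hproc : R.proc y with
  | none => exact absurd hp' (hR.work_conserving y hy0 hproc i' r')
  | some p =>
    obtain ⟨i, r⟩ := p
    obtain ⟨hp, hedf⟩ := hR.edf y hy0 i r hproc
    have hdl : R.deadline S i r y ≤ d := (hedf i' r' hp').trans hd'
    refine ⟨i, r, rfl, ?_, hp.1, hp.2.1, hdl⟩
    by_contra! hrs
    have h1 := hsZ i r hrs (hp.mono hrs.le hsy.le)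
    have h2 : R.deadline S i r s ≤ R.deadline S i r y := deadline_mono hsy.le (hno y hyd)
    linarith

/-- If `P` implies `Q`, then `Q` switches no later than `P`. -/
theorem switch_le {s d x x' : ℝ} {P Q : ℝ → Prop} (hsx : s ≤ x) (hxd : x' ≤ d)
    (hP : ∀ y, x < y → y < d → P y) (hQ : ∀ y, s ≤ y → y < x' → ¬ Q y)
    (hPQ : ∀ y, P y → Q y) : x' ≤ x := by
  by_contra! hlt
  obtain ⟨y, h1, h2⟩ := exists_between hlt
  exact hQ y (hsx.trans h1.le) h2 (hPQ y (hP y h1 (h2.trans_le hxd)))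

/-- The processor is never idle in `(s,d)`, so its service to the jobs in `J` adds up to at least
`d - s`. -/
theorem length_le_sum_served [Fintype ι] {s d : ℝ} (hs : 0 ≤ s) (hsd : s ≤ d)
    (J : ι → Finset ℝ)
    (h : ∀ y, s < y → y < d → ∃ i r, R.proc y = some (i, r) ∧ r ∈ J i) :
    d - s ≤ ∑ p ∈ Finset.univ.sigma J, R.served p.1 p.2 d := by
  have hsub : Set.Ioo s d ⊆ ⋃ p ∈ Finset.univ.sigma J,
      {y : ℝ | 0 ≤ y ∧ y < d ∧ R.proc y = some (p.1, p.2)} := by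
    intro y hy
    obtain ⟨i, r, hp, hr⟩ := h y hy.1 hy.2
    exact Set.mem_biUnion (x := (⟨i, r⟩ : Σ _ : ι, ℝ)) (by simpa using hr)
      ⟨hs.trans hy.1.le, hy.2, hp⟩
  have hle := (measure_mono (μ := volume) hsub).trans (measure_biUnion_finset_le _ _)
  rw [Real.volume_Ioo] at hle
  have h2 := ENNReal.toReal_mono
    (ENNReal.sum_ne_top.2 fun p _ => R.servedSet_ne_top p.1 p.2 d) hle
  rw [ENNReal.toReal_ofReal (sub_nonneg.2 hsd),
    ENNReal.toReal_sum fun p _ => R.servedSet_ne_top p.1 p.2 d] at h2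
  exact h2

/-- The switching instants in an interval `[s,d)` without resets, in the form in which the test
covers them: `tE` for the external switch of the system, `tI j` for the internal switch of component
`j` or `tE` if that is earlier, `x i` for task `i`. A switch before `s` counts as one at `s`, and one
that does not take place before `d` as one at `d`. -/
theorem exists_switches [Fintype ι] {s d : ℝ} (hsd : s ≤ d) (hno : ∀ y, y < d → R.NoReset s y) :
    ∃ (tE : ℝ) (tI : κ → ℝ) (x : ι → ℝ), tE ≤ d ∧ (∀ j, s ≤ tI j ∧ tI j ≤ tE) ∧ s ≤ tE ∧
      (∀ i, s ≤ x i ∧ x i ≤ tE) ∧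
      (∀ i, S.TL (S.comp i) = 0 → x i = tE) ∧
      (∀ i, (S.task i).crit = Criticality.LC → x i = tI (S.comp i)) ∧
      (∀ i, (S.task i).crit = Criticality.HC → tI (S.comp i) ≤ x i) ∧
      (∀ j (G : Finset ι), G ⊆ S.hcTasks j → (∀ i ∈ G, x i ≠ tE) → G.card ≤ S.TL j) ∧
      (∀ i y, s ≤ y → y < x i → ¬ R.Switched S i y) ∧
      (∀ i y, x i < y → y < d → R.Switched S i y) := by
  have hno' : ∀ x y, s ≤ x → y < d → R.NoReset x y := fun x y hsx hyd j z hz hxz =>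
    hno y hyd j z hz ⟨hsx.trans_lt hxz.1, hxz.2⟩
  obtain ⟨xE, hsE, hEd, hE1, hE2⟩ := exists_switch hsd (R.SystemHC S)
    fun x y hx hxy hy h => h.mono hxy (hno' x y hx hy)
  choose xI hsI hId hI1 hI2 using fun j => exists_switch hsd (R.InternalHC S j)
    fun x y hx hxy hy h => h.mono hxy (hno' x y hx hy)
  choose xO hsO hOd hO1 hO2 using fun i => exists_switch hsd (R.Overrun S i)
    fun x y hx hxy hy h => h.mono hxy (hno' x y hx hy)
  have hEI : ∀ j, S.TL j = 0 → xE ≤ xI j := fun j hj =>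
    switch_le (hsI j) hEd (hI2 j) hE1 fun y h => h.systemHC hj
  have hint : ∀ i, (S.task i).crit = Criticality.HC → xI (S.comp i) ≤ xO i := fun i hi =>
    switch_le (hsO i) (hId _) (hO2 i) (hI1 _) fun y h => internalHC_of_overrun hi h
  let x : ι → ℝ := fun i => match (S.task i).crit with
    | Criticality.LC => min (xI (S.comp i)) xE
    | Criticality.HC => min (xO i) xE
  have hxLC : ∀ i, (S.task i).crit = Criticality.LC → x i = min (xI (S.comp i)) xE :=
    fun i hi => by simp only [x, hi]
  have hxHC : ∀ i, (S.task i).crit = Criticality.HC → x i = min (xO i) xE :=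
    fun i hi => by simp only [x, hi]
  refine ⟨xE, fun j => min (xI j) xE, x, hEd, fun j => ⟨le_min (hsI j) hsE, min_le_right _ _⟩, hsE,
    fun i => ?_, fun i hi => ?_, hxLC, fun i hi => ?_, fun j G hG hne => ?_, fun i y hsy hy => ?_,
    fun i y hy hyd => ?_⟩
  · cases hi : (S.task i).crit
    · rw [hxLC i hi]; exact ⟨le_min (hsI _) hsE, min_le_right _ _⟩
    · rw [hxHC i hi]; exact ⟨le_min (hsO _) hsE, min_le_right _ _⟩
  · have := hEI _ hi
    cases hc : (S.task i).crit
    · rw [hxLC i hc, min_eq_right this]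
    · rw [hxHC i hc, min_eq_right (this.trans (hint i hc))]
  · rw [hxHC i hi]
    exact min_le_min_right _ (hint i hi)
  · rcases G.eq_empty_or_nonempty with rfl | hGne
    · simp
    have hlt : G.sup' hGne xO < xE := by
      rw [Finset.sup'_lt_iff]
      intro i hi
      have := hne i hi
      rw [hxHC i (S.mem_hcTasks.1 (hG hi)).2] at this
      by_contra! hle
      exact this (min_eq_right hle)
    -- just before the external switch all tasks of `G` have overrun
    obtain ⟨y, h1, h2⟩ := exists_between hlt
    have hOy : ∀ i ∈ G, xO i < y := fun i hi => (Finset.le_sup' xO hi).trans_lt h1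
    obtain ⟨i₁, hi₁⟩ := hGne
    have hnot : ¬ R.ExternalHC S j y := fun h =>
      hE1 y ((hsO i₁).trans (hOy i₁ hi₁).le) h2 ⟨j, h⟩
    rw [ExternalHC, not_lt] at hnot
    rw [← Set.ncard_coe_finset]
    refine (Set.ncard_le_ncard (fun i hi => ?_) (Set.toFinite _)).trans hnot
    have hi' := S.mem_hcTasks.1 (hG hi)
    exact ⟨hi'.1, hi'.2, hO2 i y (hOy i hi) (h2.trans_le hEd)⟩
  · cases hi : (S.task i).crit
    · rw [hxLC i hi, lt_min_iff] at hy
      rw [switched_lc hi]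
      exact not_or.2 ⟨hI1 _ y hsy hy.1, hE1 y hsy hy.2⟩
    · rw [hxHC i hi, lt_min_iff] at hy
      rw [switched_hc hi]
      exact not_or.2 ⟨hO1 _ y hsy hy.1, hE1 y hsy hy.2⟩
  · cases hi : (S.task i).crit
    · rw [hxLC i hi, min_lt_iff] at hy
      exact (switched_lc hi).2 (hy.imp (fun h => hI2 _ y h hyd) (fun h => hE2 y h hyd))
    · rw [hxHC i hi, min_lt_iff] at hy
      exact (switched_hc hi).2 (hy.imp (fun h => hO2 _ y h hyd) (fun h => hE2 y h hyd))

/-- If a task is not switched before `d`, its switching point in `[r,d]` is `d`. -/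
theorem switch_eq {i : ι} {r x d : ℝ} (hrd : r < d) (hxd : x ≤ d)
    (hafter : ∀ y, r ≤ y → x < y → y < d → R.Switched S i y)
    (hnot : ∀ y, r ≤ y → y < d → ¬ R.Switched S i y) : x = d := by
  refine hxd.antisymm (le_of_not_gt fun hlt => ?_)
  obtain ⟨y, h1, h2⟩ := exists_between (max_lt hlt hrd)
  have hr := (le_max_right x r).trans h1.le
  exact hnot y hr h2 (hafter y hr ((le_max_left x r).trans_lt h1) h2)

/-! ### Correctness of the test -/

variable [Fintype κ] [Fintype ι]

/-- Under the test, a job which has priority for an instant `d` from its release up to `d` receives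
by `d` any amount of service which its demand is known to cover. -/
theorem Legal.le_served (hR : R.Legal S) (hS : S.PassesTest) {i₀ : ι} {r₀ d req : ℝ}
    (hr₀ : r₀ ∈ R.rel i₀) (hr₀d : r₀ < d)
    (hbusy : ∀ x, r₀ ≤ x → x < d → R.Pending S i₀ r₀ x ∧ R.deadline S i₀ r₀ x ≤ d)
    (htight : ∀ i, (S.task i).crit = Criticality.HC → ∀ r ∈ R.rel i,
      r + (S.task i).DL < d → R.MeetsTightened S i r)
    (hreq : ∀ x t, x ≤ d → d < t → (∀ y, r₀ ≤ y → y < x → ¬ R.Switched S i₀ y) →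
      (∀ y, r₀ ≤ y → x < y → y < d → R.Switched S i₀ y) → req ≤ (S.task i₀).demand t x r₀) :
    req ≤ R.served i₀ r₀ d := by
  classical
  by_contra! hmiss
  obtain ⟨s, hs0, hsr, hno, hproc⟩ := hR.exists_busy_start hr₀ hbusy
  have hsd : s ≤ d := hsr.trans hr₀d.le
  obtain ⟨tE, tI, x, hEd, hI, hE, hx, hx0, hxLC, hxHC, hTL, hbef, haft⟩ :=
    exists_switches (S := S) hsd hno
  have hsep : ∀ i, Separated (S.task i).T (R.rel i) := hR.rel_sep
  have hfin : ∀ i, (R.rel i ∩ Set.Icc s d).Finite := fun i => (hsep i).finite (S.task i).T_pos s d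
  set J : ι → Finset ℝ := fun i => (hfin i).toFinset with hJ
  have hmem : ∀ i r, r ∈ J i ↔ r ∈ R.rel i ∧ s ≤ r ∧ r ≤ d := fun i r => by
    simp [hJ, Set.mem_inter_iff]
  have hlen := length_le_sum_served hs0 hsd J fun y hsy hyd => by
    obtain ⟨i, r, hp, h1, h2, h3, -⟩ := hproc y hsy hyd
    exact ⟨i, r, hp, (hmem i r).2 ⟨h2, h1, h3.trans hyd.le⟩⟩
  -- the interval is enlarged by less than the amount that is missing
  obtain ⟨t, hdt, ht, hgen⟩ := MCSystem.exists_generic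
    (show d < d + (req - R.served i₀ r₀ d) by linarith) x (fun i => (S.task i).T)
  have hdem : ∀ p ∈ Finset.univ.sigma J,
      0 ≤ (S.task p.1).demand t (x p.1) p.2 - R.served p.1 p.2 d := by
    rintro ⟨i, r⟩ hp
    obtain ⟨hr, hsr', -⟩ := (hmem i r).1 (by simpa using hp)
    rw [sub_nonneg]
    refine hR.served_le_demand hr ((hx i).2.trans hEd) hdt (fun y hry hyd hpy => ?_)
      (fun y hyd j z hz hrz => hno y hyd j z hz ⟨hsr'.trans_lt hrz.1, hrz.2⟩)
      (fun y hy => hbef i y (hsr'.trans hy)) (fun y _ => haft i y) (fun hi => htight i hi r hr)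
    obtain ⟨i', r', hp', -, -, -, hdl⟩ := hproc y (hsr'.trans_lt hry) hyd
    rw [hpy, Option.some_inj, Prod.mk.injEq] at hp'
    rw [hp'.1, hp'.2]
    exact hdl
  have h0 : (⟨i₀, r₀⟩ : Σ _ : ι, ℝ) ∈ Finset.univ.sigma J := by
    simpa using (hmem i₀ r₀).2 ⟨hr₀, hsr, hr₀d.le⟩
  have h1 := Finset.single_le_sum hdem h0
  rw [Finset.sum_sub_distrib] at h1
  have h2 : req ≤ (S.task i₀).demand t (x i₀) r₀ :=
    hreq (x i₀) t ((hx i₀).2.trans hEd) hdt (fun y hy => hbef i₀ y (hsr.trans hy))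
      (fun y _ => haft i₀ y)
  have h3 := hS.sum_demand_le (t := t - s) (tE := tE - s) (tI := fun j => tI j - s)
    (fun j => ⟨by linarith [(hI j).1], by linarith [(hI j).2]⟩) (by linarith) (by linarith)
    (fun i => x i - s) (fun i => (J i).image (· - s))
    (fun i r hr => by
      obtain ⟨r', hr', rfl⟩ := Finset.mem_image.1 hr
      linarith [((hmem i r').1 hr').2.1])
    (fun i r hr r' hr' hlt => by
      obtain ⟨a, ha, rfl⟩ := Finset.mem_image.1 hr
      obtain ⟨b, hb, rfl⟩ := Finset.mem_image.1 hr'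
      linarith [hsep i a ((hmem i a).1 ha).1 b ((hmem i b).1 hb).1 (by linarith)])
    (fun i n => by rw [sub_sub_sub_cancel_right]; exact hgen i n)
    (fun i hi => by rw [hx0 i hi])
    (fun i hi _ => by rw [hxLC i hi])
    (fun i hi => ⟨by linarith [hxHC i hi], by linarith [(hx i).2]⟩)
    (fun j _ => hTL j _ (Finset.filter_subset _ _) fun i hi heq =>
      (Finset.mem_filter.1 hi).2 (by rw [heq]))
  have h4 : ∑ p ∈ Finset.univ.sigma J, (S.task p.1).demand t (x p.1) p.2 ≤ t - s := by
    rw [Finset.sum_sigma]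
    refine le_trans (le_of_eq (Finset.sum_congr rfl fun i _ => ?_)) h3
    rw [Finset.sum_image fun a _ b _ h => sub_left_injective h]
    simp only [MCTask.demand_sub]
  simp only at h1
  linarith

/-- A tightened requirement cannot be the first one to be missed. -/
theorem Legal.meetsTightened_of_lt (hR : R.Legal S) (hS : S.PassesTest) {i₀ : ι} {r₀ : ℝ}
    (hi₀ : (S.task i₀).crit = Criticality.HC) (hr₀ : r₀ ∈ R.rel i₀)
    (htight : ∀ i, (S.task i).crit = Criticality.HC → ∀ r ∈ R.rel i,
      r + (S.task i).DL < r₀ + (S.task i₀).DL → R.MeetsTightened S i r) :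
    R.MeetsTightened S i₀ r₀ := by
  intro hLC
  have hDL := (S.task i₀).DL_pos
  by_contra! hmiss
  have hnot : ∀ y, r₀ ≤ y → y < r₀ + (S.task i₀).DL → ¬ R.Switched S i₀ y := by
    rintro y h1 h2 (h | h)
    · exact hLC y h1 h2 h
    · rw [h.1] at hi₀; cases hi₀
  refine absurd (hR.le_served hS (d := r₀ + (S.task i₀).DL) hr₀ (by linarith) (fun x h1 h2 => ?_)
    htight fun x t hxd hdt _ haft => ?_) (not_le.2 hmiss)
  · refine ⟨⟨hr₀, h1, ?_, fun y h3 h4 h5 => hnot y h3 (h4.trans_lt h2) (Or.inr h5)⟩, ?_⟩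
    · exact (R.served_mono i₀ r₀ h2.le).trans_lt (hmiss.trans_le (min_le_left _ _))
    · rw [deadline, if_neg (hLC x h1 h2)]
  · rw [switch_eq (by linarith) hxd haft hnot]
    refine (min_le_right _ _).trans ?_
    have hfit := hS.CL_le_DL i₀ hi₀
    simp only [MCTask.demand, hi₀, MCTask.hcDemand, MCTask.lcDemand]
    rw [if_neg (lt_irrefl _), if_pos hdt.le, add_sub_cancel_left, min_eq_right hfit]
    split_ifs
    · exact (S.task i₀).CL_le_CH
    · exact le_max_right _ _

theorem Legal.meetsTightened (hR : R.Legal S) (hS : S.PassesTest) (i : ι)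
    (hi : (S.task i).crit = Criticality.HC) (r : ℝ) (hr : r ∈ R.rel i) :
    R.MeetsTightened S i r := by
  by_contra hcon
  set b := r + (S.task i).DL with hb
  -- among the finitely many violations up to `b` there is a first one
  set V : Set (ι × ℝ) := {p | (S.task p.1).crit = Criticality.HC ∧ p.2 ∈ R.rel p.1 ∧
    p.2 + (S.task p.1).DL ≤ b ∧ ¬ R.MeetsTightened S p.1 p.2} with hV
  have hfin : V.Finite := by
    refine Set.Finite.subset (Set.finite_iUnion fun k : ι =>
      (((show Separated (S.task k).T (R.rel k) from hR.rel_sep k).finite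
        (S.task k).T_pos 0 b).image (Prod.mk k))) ?_
    rintro ⟨k, q⟩ ⟨-, hq, hqb, -⟩
    have hqb' : q + (S.task k).DL ≤ b := hqb
    refine Set.mem_iUnion.2 ⟨k, q, ⟨hq, hR.rel_nonneg k q hq, ?_⟩, rfl⟩
    linarith [(S.task k).DL_pos]
  obtain ⟨⟨k, q⟩, ⟨hk, hq, hqb, hviol⟩, hmin⟩ :=
    V.exists_min_image (fun p => p.2 + (S.task p.1).DL) hfin ⟨(i, r), hi, hr, le_rfl, hcon⟩
  refine hviol (hR.meetsTightened_of_lt hS hk hq fun k' hk' q' hq' hlt => ?_)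
  by_contra hcon'
  exact not_le.2 hlt (hmin (k', q') ⟨hk', hq', hlt.le.trans hqb, hcon'⟩)

theorem Legal.meetsRequirements (hR : R.Legal S) (hS : S.PassesTest) :
    R.MeetsRequirements S where
  hc_tightened i hi r hr := hR.meetsTightened hS i hi r hr
  hc_deadline i hi r hr := by
    have hD := (S.task i).D_pos
    by_contra! hmiss
    have hpend : ∀ x, r ≤ x → x < r + (S.task i).D → R.Pending S i r x := fun x h1 h2 =>
      ⟨hr, h1, (R.served_mono i r h2.le).trans_lt hmiss, fun y _ _ h => by
        rw [h.1] at hi; cases hi⟩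
    refine absurd (hR.le_served hS (d := r + (S.task i).D) hr (by linarith)
      (fun x h1 h2 => ⟨hpend x h1 h2, deadline_le i r x⟩)
      (fun i hi r hr _ => hR.meetsTightened hS i hi r hr) fun x t hxd hdt hbef _ => ?_)
      (not_le.2 hmiss)
    simp only [MCTask.demand, hi, MCTask.hcDemand]
    split_ifs with h1 h2
    · have h0 := (S.task i).DL_pos
      exact exec_le_CL hi hr (hR.meetsTightened hS i hi r hr) h1 hbef
        (hR.noReset_of_pending le_rfl (hpend _ (by linarith) (by linarith)))
    · exact hR.exec_le i r hr
    · exact absurd hdt.le h2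
  lc_deadline i hi r hr hdrop := by
    have hD := (S.task i).D_pos
    have hDL := (S.task i).lc_deadline hi
    by_contra! hmiss
    have hnot : ∀ y, r ≤ y → y < r + (S.task i).D → ¬ R.Switched S i y := by
      rintro y h1 h2 (h | h)
      · rw [h.1] at hi; cases hi
      · exact hdrop y h1 h2 h
    refine absurd (hR.le_served hS (d := r + (S.task i).D) hr (by linarith)
      (fun x h1 h2 => ⟨⟨hr, h1, (R.served_mono i r h2.le).trans_lt hmiss,
        fun y h3 h4 => hdrop y h3 (h4.trans_lt h2)⟩, deadline_le i r x⟩)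
      (fun i hi r hr _ => hR.meetsTightened hS i hi r hr) fun x t hxd hdt _ haft => ?_)
      (not_le.2 hmiss)
    rw [switch_eq (by linarith) hxd haft hnot]
    simp only [MCTask.demand, hi, MCTask.lcDemand]
    rw [hDL, if_pos hdt.le, add_sub_cancel_left, min_eq_right ((S.task i).lc_fit hi),
      (S.task i).lc_wcet hi]
    exact (hR.exec_le i r hr).trans (le_max_right _ _)

end Run

end

theorem theorem1 :
    (∀ (κ ι : Type) [Fintype κ] [Fintype ι] (S : MCSystem κ ι), S.PassesTest → S.Schedulable) ∧
    (∃ P : Polynomial ℝ, ∀ ε : ℝ, 0 < ε → ∀ (κ ι : Type) [Fintype κ] [Fintype ι]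
      (S : MCSystem κ ι), S.Integral → ε ≤ S.slack →
        S.tMax ≤ ((P.eval S.unarySize / ε : ℝ) : EReal)) := by
  refine ⟨fun κ ι _ _ S hS R hR => hR.meetsRequirements hS,
    2 * Polynomial.X ^ 2 + Polynomial.X, fun ε hε κ ι _ _ S hInt hs => ?_⟩
  simpa using S.tMax_le hInt hε hs
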